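/- Let $\{a_n\}_{n\ge 0}$ be a sequence of (real or complex) numbers satisfying the $L^2$-Hausdorff condition: there is a constant $M>0$ such that $$(n+1)\sum_{i=0}^n\binom{n}{i}^2\left|\Delta^i a_{n-i}\right|^2<M\qquad(n=0,1,2,\ldots),\qquad \Delta a_k=a_{k+1}-a_k .$$ Then the Taylor series $\frac1{2\pi}\sum_{n=0}^\infty a_nz^n$ converges in $|z|<1$ and its sum extends to a (necessarily unique) holomorphic function $f$ on the cut plane $\mathbb{C}\setminus[1,+\infty)$. For almost every $x\in(1,+\infty)$ the boundary values $f_\pm(x)=\lim_{\varepsilon\downarrow0}f(x\pm i\varepsilon)$ exist, and the jump function $F(x)=-i\,(f_+(x)-f_-(x))$ belongs to $L^2(1,+\infty)$ and is the sum of the series $$F(x)=\sum_{m=0}^\infty c_m\,\phi_m(x)\qquad(x\in(1,+\infty)),$$ which converges in the norm of $L^2(1,+\infty)$, where $$c_m=\sqrt2\,\sum_{n=0}^\infty\frac{(-1)^n}{n!}\,a_n\,P_m\!\left[-i\left(n+\tfrac12\right)\right],\qquad \phi_m(x)=i^m\sqrt2\,L_m\!\left(\frac2x\right)\frac{e^{-1/x}}{x},$$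 the sums defining the $c_m$ being absolutely convergent. Here $L_m(t)=\sum_{k=0}^m\binom mk\frac{(-t)^k}{k!}$ are the Laguerre polynomials, and $P_m$ are the Pollaczek polynomials, i.e. the polynomials with positive leading coefficients that are orthonormal on $\mathbb{R}$ for the weight $\frac1\pi|\Gamma(\frac12+i\nu)|^2$; they are given by $P_0=1$, $P_1(\nu)=2\nu$, $(m+2)P_{m+2}(\nu)=2\nu P_{m+1}(\nu)-(m+1)P_m(\nu)$. Moreover $F$ solves the Cauchy integral equation $$f(z)=\frac1{2\pi}\int_1^{+\infty}\frac{F(x)}{x-z}\,dx\qquad(z\in\mathbb{C}\setminus[1,+\infty)),$$ the integral being absolutely convergent. -/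

import Mathlib

/-- The `L²` Hausdorff condition: there is a positive constant `M` such that, for every `n`,
`(n + 1) * ∑_{i = 0}^{n} (n.choose i)² |Δ^i a_{n-i}|² < M`, where `Δ a_k = a_{k+1} - a_k`. -/
def HausdorffL2Condition (a : ℕ → ℂ) : Prop :=
  ∃ M : ℝ, 0 < M ∧ ∀ n : ℕ,
    ((n : ℝ) + 1) * ∑ i ∈ Finset.range (n + 1),
      ((n.choose i : ℝ)) ^ 2 * ‖(fwdDiff 1)^[i] a (n - i)‖ ^ 2 < M

/-- The complex plane cut along the half-line `[1, +∞)` of the real axis. -/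
def cutPlane : Set ℂ := {z : ℂ | z.im ≠ 0 ∨ z.re < 1}

/-- `f` is holomorphic in the cut plane, and in the unit disk it is the sum of the
Taylor series `(1 / 2π) ∑ a_n z^n`. -/
def IsCutPlaneExtension (a : ℕ → ℂ) (f : ℂ → ℂ) : Prop :=
  DifferentiableOn ℂ f cutPlane ∧
    ∀ z : ℂ, ‖z‖ < 1 →
      HasSum (fun n : ℕ => 1 / (2 * (Real.pi : ℂ)) * (a n * z ^ n)) (f z)

/-- `F` is the jump function of `f` across the cut: for almost every `x > 1` the boundary values
`f₊ x = lim f (x + i ε)` and `f₋ x = lim f (x - i ε)` (as `ε ↓ 0`) both exist, and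
`F x = - i (f₊ x - f₋ x)`. -/
def IsJumpFunction (f : ℂ → ℂ) (F : ℝ → ℂ) : Prop :=
  ∀ᵐ x : ℝ ∂(MeasureTheory.volume.restrict (Set.Ioi (1 : ℝ))), ∃ fp fm : ℂ,
    Filter.Tendsto (fun ε : ℝ => f ((x : ℂ) + Complex.I * (ε : ℂ)))
      (nhdsWithin 0 (Set.Ioi 0)) (nhds fp) ∧
    Filter.Tendsto (fun ε : ℝ => f ((x : ℂ) - Complex.I * (ε : ℂ)))
      (nhdsWithin 0 (Set.Ioi 0)) (nhds fm) ∧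
    F x = -Complex.I * (fp - fm)

/-- The Pollaczek polynomials `P_m = P_m^{(1/2)}` (Meixner-Pollaczek, `λ = 1/2`, `φ = π/2`), given
by their three-term recurrence `(m + 2) P_{m+2} = 2 ν P_{m+1} - (m + 1) P_m`, `P_0 = 1`,
`P_1 = 2 ν`. These are the polynomials with positive leading coefficients that are orthonormal on
the real line for the weight `(1 / π) |Γ(1/2 + i ν)|²`. -/
noncomputable def pollaczekPoly : ℕ → Polynomial ℝ
  | 0 => 1
  | 1 => 2 * Polynomial.X
  | m + 2 => Polynomial.C (1 / ((m : ℝ) + 2)) *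
      (2 * Polynomial.X * pollaczekPoly (m + 1) -
        Polynomial.C ((m : ℝ) + 1) * pollaczekPoly m)

/-- The Laguerre polynomials `L_m(t) = ∑_{k = 0}^{m} (m.choose k) (-t)^k / k!`. -/
noncomputable def laguerrePoly (m : ℕ) (t : ℝ) : ℝ :=
  ∑ k ∈ Finset.range (m + 1), (m.choose k : ℝ) * (-t) ^ k / (k.factorial : ℝ)

/-- The `n`-th term `((-1)^n / n!) a_n P_m(-i (n + 1/2))` of the sum that gives the `m`-th
coefficient. -/
noncomputable def pollaczekTerm (a : ℕ → ℂ) (m n : ℕ) : ℂ :=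
  (-1) ^ n / (n.factorial : ℂ) * a n *
    Polynomial.aeval (-Complex.I * ((n : ℂ) + 1 / 2)) (pollaczekPoly m)

/-- The coefficient `c_m = √2 ∑_{n ≥ 0} ((-1)^n / n!) a_n P_m(-i (n + 1/2))`. -/
noncomputable def pollaczekCoeff (a : ℕ → ℂ) (m : ℕ) : ℂ :=
  (Real.sqrt 2 : ℂ) * ∑' n : ℕ, pollaczekTerm a m n

/-- The functions `φ_m(x) = i^m √2 L_m(2 / x) e^{-1/x} / x`. -/
noncomputable def laguerreBasisFun (m : ℕ) (x : ℝ) : ℂ :=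
  Complex.I ^ m * ((Real.sqrt 2 * laguerrePoly m (2 / x) * (Real.exp (-1 / x) / x) : ℝ) : ℂ)

open MeasureTheory Filter Topology Set FourierTransform SchwartzMap

/-! The condition says exactly enough for the `a n` to be moments `∫₀¹ tⁿ g(t) dt` of some `g ∈
L²(0,1)`. Since the shift is `1 + Δ`, the number `∑ c_j a_j` can be written through the differences
`(-1)^i C(n,i) Δ^i a_{n-i}`, paired with a discretisation of the polynomial `p(t) = ∑ c_j t^j`.
Cauchy–Schwarz bounds it by a Riemann sum of `|p|²`; as `n → ∞` the functional `p ↦ ∑ c_j a_j` is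
seen to be bounded in the `L²(0,1)` norm, and Hahn–Banach and Riesz give `g`
(`HausdorffL2Condition.exists_moments`).

Summing the geometric series, `f(z) = (1/2π) ∫₀¹ g(t)/(1 - tz) dt`, which is holomorphic on the cut
plane. The substitution `x = 1/t` turns this into the Cauchy integral of `F(x) = g(1/x)/x`, and `g ↦
F` is an isometry from `L²(0,1)` onto `L²(1,∞)`. That `F` is the jump is the Plemelj formula in `L²`
(`exists_tendsto_cauchyIntegral_ae`): the difference of the values at `x ± iε` is a Poisson
integral, convergent at Lebesgue points; each one-sided value is also a Poisson integral, of a Hardy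
projection obtained by cutting the Fourier side to a half-line.

For the series, `g` extended by zero is expanded in the Laguerre functions `√2 L_m(2t) e^{-t}`, an
orthonormal basis of `L²(0,∞)`. The coefficients reduce to the stated sums because `i^m
P_m(-i(n+1/2))` is the Delannoy number `∑ C(m,k) 2^k C(n,k)` and `∑_n (-1)^n C(n,k) t^n / n! =
(-t)^k e^{-t} / k!`. -/

/-! ### The Hausdorff moment problem in `L²(0,1)`. -/

theorem MeasureTheory.MemLp.norm_toLp_two_sq {α E : Type*} [MeasurableSpace α] {μ : Measure α}
    [NormedAddCommGroup E] {f : α → E} (hf : MemLp f 2 μ) :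
    ‖hf.toLp f‖ ^ 2 = ∫ x, ‖f x‖ ^ 2 ∂μ := by
  rw [Lp.norm_toLp, hf.eLpNorm_eq_integral_rpow_norm (by norm_num) (by norm_num)]
  have h0 : 0 ≤ ∫ x, ‖f x‖ ^ 2 ∂μ := integral_nonneg fun x => by positivity
  simp only [ENNReal.toReal_ofNat, Real.rpow_ofNat]
  rw [ENNReal.toReal_ofReal (by positivity), ← Real.rpow_mul_natCast h0]
  norm_num

/-- The inversion of the binomial transform of finite differences. -/
theorem sum_choose_mul_fwdDiff_iter (a : ℕ → ℂ) (N j : ℕ) :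
    ∑ i ∈ Finset.range (N + 1), (N.choose i : ℂ) * ((-1) ^ i * (fwdDiff 1)^[i] a (j + (N - i)))
      = a j := by
  -- The shift is `1 + Δ`, so `-Δ + shift` is the identity; its `N`-th power is expanded binomially.
  open fwdDiff_aux in
  have hc : (-fwdDiffₗ ℕ ℂ 1 + shiftₗ ℕ ℂ 1) ^ N = 1 := by
    simp [shiftₗ]
  open fwdDiff_aux in
  have hcomm : Commute (-fwdDiffₗ ℕ ℂ 1) (shiftₗ ℕ ℂ 1) := by
    unfold shiftₗ
    exact ((Commute.refl _).add_right (Commute.one_right _)).neg_left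
  rw [hcomm.add_pow] at hc
  have h := congrFun (LinearMap.congr_fun hc a) j
  simp only [LinearMap.coe_sum, Finset.sum_apply, Module.End.one_apply] at h
  rw [← h]
  refine Finset.sum_congr rfl fun i hi => ?_
  rw [(hcomm.pow_pow i (N - i)).eq, ← Nat.cast_comm, neg_pow (fwdDiff_aux.fwdDiffₗ ℕ ℂ 1),
    Module.End.mul_apply, Module.End.mul_apply, Module.End.mul_apply]
  rw [Module.End.natCast_apply, Pi.smul_apply, nsmul_eq_mul, fwdDiff_aux.shiftₗ_pow_apply]
  congr 1
  have : ((-1 : Module.End ℤ (ℕ → ℂ)) ^ i) = (((-1 : ℤ) ^ i : ℤ) : Module.End ℤ (ℕ → ℂ)) := by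
    push_cast; rfl
  rw [this, Module.End.intCast_apply, Pi.smul_apply, zsmul_eq_mul, ← fwdDiff_aux.coe_fwdDiffₗ_pow]
  simp

/-- The inversion formula is applied to each `a j` with `N = n - j`, and `C(n,j) C(n-j,i) = C(n,i)
C(n-i,j)` separates the dependence on `j`. The ratio `C(k,j)/C(n,j)` plays the role of `(k/n)^j`. -/
theorem sum_mul_eq_sum_fwdDiff_iter (a c : ℕ → ℂ) {d n : ℕ} (h : d ≤ n + 1) :
    ∑ j ∈ Finset.range d, c j * a j =
      ∑ i ∈ Finset.range (n + 1), ((-1) ^ i * (n.choose i) * (fwdDiff 1)^[i] a (n - i)) *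
        ∑ j ∈ Finset.range d, c j * ((n - i).choose j / n.choose j) := by
  simp_rw [Finset.mul_sum]
  rw [Finset.sum_comm]
  refine Finset.sum_congr rfl fun j hj => ?_
  have hjn : j ≤ n := by have := Finset.mem_range.1 hj; omega
  rw [← sum_choose_mul_fwdDiff_iter a (n - j) j, Finset.mul_sum]
  have hsub : Finset.range (n - j + 1) ⊆ Finset.range (n + 1) :=
    Finset.range_subset_range.2 (by omega)
  refine (Finset.sum_subset_zero_on_sdiff hsub ?_ ?_)
  · intro i hi
    simp only [Finset.mem_sdiff, Finset.mem_range] at hi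
    rw [Nat.choose_eq_zero_of_lt (by omega : n - i < j)]
    simp
  · intro i hi
    have hi := Finset.mem_range.1 hi
    have hC : (n.choose i : ℂ) * ((n - i).choose j) = n.choose j * ((n - j).choose i) := by
      norm_cast
      have h1 := Nat.choose_mul (n := n) (k := i + j) (s := j) (by omega)
      have h2 := Nat.choose_mul (n := n) (k := i + j) (s := i) (by omega)
      rw [show (i + j).choose j = (i + j).choose i from Nat.choose_symm_add.symm, h2] at h1
      simpa [Nat.add_sub_cancel_left, Nat.add_sub_cancel] using h1
    have hne : (n.choose j : ℂ) ≠ 0 := by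
      exact_mod_cast (Nat.choose_pos hjn).ne'
    rw [show j + (n - j - i) = n - i by omega]
    field_simp
    linear_combination (- c j * (fwdDiff 1)^[i] a (n - i)) * hC

theorem HausdorffL2Condition.norm_sum_sq_le {a : ℕ → ℂ} {M : ℝ}
    (h : ∀ n : ℕ, ((n : ℝ) + 1) * ∑ i ∈ Finset.range (n + 1),
      ((n.choose i : ℝ)) ^ 2 * ‖(fwdDiff 1)^[i] a (n - i)‖ ^ 2 < M)
    (c : ℕ → ℂ) {d n : ℕ} (hd : d ≤ n + 1) :
    ‖∑ j ∈ Finset.range d, c j * a j‖ ^ 2 ≤ M * ((1 / ((n : ℝ) + 1)) *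
      ∑ k ∈ Finset.range (n + 1),
        ‖∑ j ∈ Finset.range d, c j * (k.choose j / n.choose j : ℂ)‖ ^ 2) := by
  rw [sum_mul_eq_sum_fwdDiff_iter a c hd]
  set q : ℕ → ℂ := fun k => ∑ j ∈ Finset.range d, c j * (k.choose j / n.choose j : ℂ)
  have hq : ∑ k ∈ Finset.range (n + 1), ‖q k‖ ^ 2 =
      ∑ k ∈ Finset.range (n + 1), ‖q (n - k)‖ ^ 2 := by
    rw [← Finset.sum_range_reflect]
    simp
  rw [hq]
  calc _ ≤ (∑ i ∈ Finset.range (n + 1),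
          ((n.choose i : ℝ) * ‖(fwdDiff 1)^[i] a (n - i)‖) * ‖q (n - i)‖) ^ 2 := by
        gcongr
        refine (norm_sum_le _ _).trans (le_of_eq ?_)
        refine Finset.sum_congr rfl fun i _ => ?_
        simp [q]
    _ ≤ (∑ i ∈ Finset.range (n + 1), ((n.choose i : ℝ) * ‖(fwdDiff 1)^[i] a (n - i)‖) ^ 2) *
          ∑ i ∈ Finset.range (n + 1), ‖q (n - i)‖ ^ 2 := Finset.sum_mul_sq_le_sq_mul_sq _ _ _
    _ ≤ (M / (n + 1)) * ∑ i ∈ Finset.range (n + 1), ‖q (n - i)‖ ^ 2 := by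
        gcongr
        rw [le_div_iff₀ (by positivity), mul_comm]
        simpa [mul_pow] using (h n).le
    _ = _ := by ring

/-- Writing the average as the integral of a step function on a fixed interval lets dominated
convergence handle the Riemann sums. -/
theorem average_sum_eq_integral_floor (u : ℕ → ℝ) (n : ℕ) :
    (1 / ((n : ℝ) + 1)) * ∑ k ∈ Finset.range (n + 1), u k =
      ∫ t in Ioo (0 : ℝ) 1, u ⌊((n : ℝ) + 1) * t⌋₊ := by
  have hpos : (0 : ℝ) < n + 1 := by positivity
  have hval : ∀ k : ℕ, ∀ t ∈ Ioo ((k : ℝ) / (n + 1)) (((k + 1 : ℕ) : ℝ) / (n + 1)),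
      u ⌊((n : ℝ) + 1) * t⌋₊ = u k := by
    intro k t ht
    congr 1
    have ht0 : 0 ≤ t := (by positivity : 0 ≤ (k : ℝ) / (n + 1)).trans ht.1.le
    rw [Nat.floor_eq_iff (by positivity)]
    have h1 := (div_lt_iff₀ hpos).1 ht.1
    have h2 := (lt_div_iff₀ hpos).1 ht.2
    push_cast at h2
    constructor <;> nlinarith
  have hle : ∀ k : ℕ, (k : ℝ) / (n + 1) ≤ ((k + 1 : ℕ) : ℝ) / (n + 1) := fun k => by
    gcongr; simp
  have hcongr : ∀ k : ℕ, ∀ᵐ t : ℝ, t ∈ uIoc ((k : ℝ) / (n + 1)) (((k + 1 : ℕ) : ℝ) / (n + 1)) →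
      u k = u ⌊((n : ℝ) + 1) * t⌋₊ := by
    intro k
    -- The floor jumps at the right endpoint, which is discarded as a null set.
    filter_upwards [compl_mem_ae_iff.2 (measure_singleton (((k + 1 : ℕ) : ℝ) / (n + 1)))]
      with t ht hmem
    rw [uIoc_of_le (hle k)] at hmem
    exact (hval k t ⟨hmem.1, lt_of_le_of_ne hmem.2 ht⟩).symm
  have hsum := intervalIntegral.sum_integral_adjacent_intervals (n := n + 1)
    (f := fun t : ℝ => u ⌊((n : ℝ) + 1) * t⌋₊) (a := fun k : ℕ => (k : ℝ) / (n + 1)) (μ := volume)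
    (fun k _ => (intervalIntegrable_const (c := u k)).congr_ae
      ((ae_restrict_iff' measurableSet_uIoc).2 (hcongr k)))
  have e1 : ((n + 1 : ℕ) : ℝ) / (n + 1) = 1 := by push_cast; field_simp
  simp only [e1] at hsum
  rw [← integral_Ioc_eq_integral_Ioo, ← intervalIntegral.integral_of_le zero_le_one]
  simp only [Nat.cast_zero, zero_div] at hsum
  rw [← hsum, Finset.mul_sum]
  refine Finset.sum_congr rfl fun k _ => ?_
  rw [← intervalIntegral.integral_congr_ae (hcongr k)]
  rw [intervalIntegral.integral_const]
  push_cast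
  rw [smul_eq_mul]
  field_simp
  ring

theorem tendsto_choose_floor_div_choose (j : ℕ) {t : ℝ} (ht : 0 < t) :
    Tendsto (fun n : ℕ => ((⌊((n : ℝ) + 1) * t⌋₊.choose j : ℝ) / (n.choose j : ℝ))) atTop
      (𝓝 (t ^ j)) := by
  have hk : Tendsto (fun n : ℕ => ⌊((n : ℝ) + 1) * t⌋₊) atTop atTop :=
    tendsto_nat_floor_atTop.comp
      ((tendsto_natCast_atTop_atTop.atTop_add tendsto_const_nhds).atTop_mul_const ht)
  have h1 := (isEquivalent_choose j).comp_tendsto hk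
  have h2 := h1.div (isEquivalent_choose j)
  refine h2.symm.tendsto_nhds ?_
  have h3 : Tendsto (fun n : ℕ => (⌊((n : ℝ) + 1) * t⌋₊ : ℝ) / (n : ℝ)) atTop (𝓝 t) := by
    have h4 := (tendsto_nat_floor_mul_div_atTop ht.le).comp
      (tendsto_natCast_atTop_atTop.atTop_add (tendsto_const_nhds (x := (1 : ℝ))) :
        Tendsto (fun n : ℕ => (n : ℝ) + 1) atTop atTop)
    have h5 := h4.mul ((tendsto_natCast_div_add_atTop (1 : ℝ)).inv₀ one_ne_zero)
    rw [inv_one, mul_one] at h5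
    refine h5.congr fun n => ?_
    have : (n : ℝ) + 1 ≠ 0 := by positivity
    simp only [Function.comp, inv_div, mul_comm t]
    field_simp
  refine (h3.pow j).congr fun n => ?_
  have : (j.factorial : ℝ) ≠ 0 := by positivity
  simp only [Function.comp, Pi.div_apply]
  rw [div_div_div_cancel_right₀ this, div_pow]

theorem tendsto_average_choose_sum (c : ℕ → ℂ) (d : ℕ) :
    Tendsto (fun n : ℕ => (1 / ((n : ℝ) + 1)) * ∑ k ∈ Finset.range (n + 1),
        ‖∑ j ∈ Finset.range d, c j * (k.choose j / n.choose j : ℂ)‖ ^ 2) atTop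
      (𝓝 (∫ t in Ioo (0 : ℝ) 1, ‖∑ j ∈ Finset.range d, c j * (t : ℂ) ^ j‖ ^ 2)) := by
  simp_rw [fun n : ℕ => average_sum_eq_integral_floor
    (fun k => ‖∑ j ∈ Finset.range d, c j * (k.choose j / n.choose j : ℂ)‖ ^ 2) n]
  refine tendsto_integral_of_dominated_convergence
    (fun _ => (∑ j ∈ Finset.range d, ‖c j‖) ^ 2) ?_ ?_ ?_ ?_
  · intro n
    refine Measurable.aestronglyMeasurable ?_
    exact (measurable_from_nat (f := fun k : ℕ =>
      ‖∑ j ∈ Finset.range d, c j * (k.choose j / n.choose j : ℂ)‖ ^ 2)).comp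
      (Nat.measurable_floor.comp (measurable_const.mul measurable_id))
  · exact integrable_const _
  · intro n
    filter_upwards [ae_restrict_mem measurableSet_Ioo] with t ht
    rw [Real.norm_of_nonneg (by positivity)]
    gcongr
    refine (norm_sum_le _ _).trans (Finset.sum_le_sum fun j _ => ?_)
    rw [norm_mul, norm_div, Complex.norm_natCast, Complex.norm_natCast]
    refine mul_le_of_le_one_right (norm_nonneg _) (div_le_one_of_le₀ ?_ (by positivity))
    have : ⌊((n : ℝ) + 1) * t⌋₊ ≤ n := by
      rw [← Nat.lt_add_one_iff, Nat.floor_lt (by have := ht.1; positivity)]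
      push_cast
      have := ht.2
      nlinarith
    exact_mod_cast Nat.choose_le_choose j this
  · filter_upwards [ae_restrict_mem measurableSet_Ioo] with t ht
    refine ((tendsto_finsetSum _ fun j _ => Tendsto.const_mul (c j) ?_).norm).pow 2
    have := (Complex.continuous_ofReal.tendsto _).comp (tendsto_choose_floor_div_choose j ht.1)
    refine (this.congr fun n => ?_).trans ?_
    · simp
    · simp

theorem HausdorffL2Condition.exists_norm_sum_sq_le {a : ℕ → ℂ} (ha : HausdorffL2Condition a) :
    ∃ M : ℝ, 0 < M ∧ ∀ (c : ℕ → ℂ) (d : ℕ), ‖∑ j ∈ Finset.range d, c j * a j‖ ^ 2 ≤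
      M * ∫ t in Ioo (0 : ℝ) 1, ‖∑ j ∈ Finset.range d, c j * (t : ℂ) ^ j‖ ^ 2 := by
  obtain ⟨M, hM, h⟩ := ha
  refine ⟨M, hM, fun c d => ?_⟩
  refine ge_of_tendsto ((tendsto_average_choose_sum c d).const_mul M) ?_
  filter_upwards [eventually_ge_atTop d] with n hn
  exact norm_sum_sq_le h c (by omega)

theorem memLp_polynomial_eval (p : Polynomial ℂ) :
    MemLp (fun t : ℝ => p.eval (t : ℂ)) 2 (volume.restrict (Ioo (0 : ℝ) 1)) := by
  have hc : Continuous fun t : ℝ => p.eval (t : ℂ) := by fun_prop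
  obtain ⟨C, hC⟩ := isCompact_Icc.exists_bound_of_continuousOn (hc.continuousOn (s := Icc 0 1))
  refine MemLp.of_bound hc.aestronglyMeasurable C ?_
  filter_upwards [ae_restrict_mem measurableSet_Ioo] with t ht
  exact hC t ⟨ht.1.le, ht.2.le⟩

/-- Polynomials as elements of `L²(0, 1)`. -/
noncomputable def polynomialToL2 :
    Polynomial ℂ →ₗ[ℂ] Lp ℂ 2 (volume.restrict (Ioo (0 : ℝ) 1)) where
  toFun p := (memLp_polynomial_eval p).toLp
  map_add' p q := by
    rw [← MemLp.toLp_add]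
    congr 1
    ext t
    simp
  map_smul' r p := by
    rw [RingHom.id_apply, ← MemLp.toLp_const_smul]
    congr 1
    ext t
    simp

/-- The solution of the Hausdorff moment problem in `L²(0, 1)`. -/
theorem HausdorffL2Condition.exists_moments {a : ℕ → ℂ} (ha : HausdorffL2Condition a) :
    ∃ g : ℝ → ℂ, StronglyMeasurable g ∧ MemLp g 2 (volume.restrict (Ioo (0 : ℝ) 1)) ∧
      ∀ n, a n = ∫ t in Ioo (0 : ℝ) 1, (t : ℂ) ^ n * g t := by
  obtain ⟨M, hM, h⟩ := ha.exists_norm_sum_sq_le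
  let Λ : Polynomial ℂ →ₗ[ℂ] ℂ := Polynomial.lsum fun n => LinearMap.mulRight ℂ (a n)
  have hΛ : ∀ p, Λ p = ∑ j ∈ Finset.range (p.natDegree + 1), p.coeff j * a j := fun p => by
    simp only [Λ, Polynomial.lsum_apply]
    rw [Polynomial.sum_over_range] <;> simp
  have hbound : ∀ p, ‖Λ p‖ ≤ √M * ‖polynomialToL2 p‖ := fun p => by
    rw [← sq_le_sq₀ (norm_nonneg _) (by positivity)]
    rw [mul_pow, Real.sq_sqrt hM.le, hΛ]
    refine (h _ _).trans (le_of_eq ?_)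
    rw [polynomialToL2]
    simp only [LinearMap.coe_mk, AddHom.coe_mk]
    rw [MemLp.norm_toLp_two_sq]
    simp_rw [Polynomial.eval_eq_sum_range]
  -- The bound forces `Λ` to vanish on polynomials with zero class in `L²`, so it descends to the
  -- range without any proof that `polynomialToL2` is injective.
  have hker : Λ ∈ (LinearMap.ker polynomialToL2).dualAnnihilator := by
    rw [Submodule.mem_dualAnnihilator]
    intro p hp
    have := hbound p
    rw [LinearMap.mem_ker.1 hp, norm_zero, mul_zero] at this
    exact norm_le_zero_iff.1 this
  rw [← LinearMap.range_dualMap_eq_dualAnnihilator_ker] at hker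
  obtain ⟨φ, hφ⟩ := hker
  have hφ' : ∀ p, φ (polynomialToL2 p) = Λ p := fun p => LinearMap.congr_fun hφ p
  let ψ : LinearMap.range polynomialToL2 →L[ℂ] ℂ :=
    (φ.domRestrict (LinearMap.range polynomialToL2)).mkContinuous (√M) (by
      rintro ⟨_, p, rfl⟩
      simpa [hφ'] using hbound p)
  obtain ⟨Ψ, hΨ, -⟩ := exists_extension_norm_eq _ ψ
  set v := (InnerProductSpace.toDual ℂ _).symm Ψ
  have hv : ∀ p, inner ℂ v (polynomialToL2 p) = Λ p := fun p => by
    rw [InnerProductSpace.toDual_symm_apply, ← hφ']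
    exact hΨ ⟨_, p, rfl⟩
  -- The Riesz vector enters the inner product conjugated, hence the conjugate.
  refine ⟨fun t => starRingEnd ℂ (v t), ?_, ?_, ?_⟩
  · exact (Lp.stronglyMeasurable v).star
  · exact (Lp.memLp v).star
  · intro n
    have h1 := hv (Polynomial.X ^ n)
    have h2 : Λ (Polynomial.X ^ n) = a n := by
      simp [Λ, Polynomial.lsum_apply, Polynomial.X_pow_eq_monomial, Polynomial.sum_monomial_index]
    rw [h2, L2.inner_def] at h1
    rw [← h1]
    refine integral_congr_ae ?_
    filter_upwards [(memLp_polynomial_eval (Polynomial.X ^ n)).coeFn_toLp] with t ht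
    rw [polynomialToL2]
    simp only [LinearMap.coe_mk, AddHom.coe_mk]
    rw [ht]
    simp

/-! ### Fourier transforms on `L¹` and `L²`. -/

theorem SchwartzMap.integral_fourier_smul_eq_of_integrable {w : ℝ → ℂ} (hw : Integrable w)
    (g : 𝓢(ℝ, ℂ)) : ∫ x, (𝓕 g) x • w x = ∫ x, g x • (𝓕 w) x := by
  simpa using! VectorFourier.integral_fourierIntegral_smul_eq_flip (L := innerₗ ℝ)
    Real.continuous_fourierChar continuous_inner g.integrable hw

/-- On `L¹ ∩ L²` the two definitions of the Fourier transform agree. -/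
theorem MeasureTheory.MemLp.fourier_toLp {w : ℝ → ℂ} (hw1 : Integrable w) (hw2 : MemLp w 2)
    (hw3 : MemLp (𝓕 w) 2) : 𝓕 (hw2.toLp w) = hw3.toLp (𝓕 w) := by
  -- The two classes are compared as tempered distributions, where the transform is defined by
  -- duality.
  have hinj : Function.Injective (Lp.toTemperedDistributionCLM ℂ (volume : Measure ℝ) 2) :=
    LinearMap.ker_eq_bot.1 Lp.ker_toTemperedDistributionCLM_eq_bot
  apply hinj
  rw [Lp.toTemperedDistributionCLM_apply, Lp.toTemperedDistributionCLM_apply,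
    ← Lp.fourier_toTemperedDistribution_eq]
  ext g
  rw [TemperedDistribution.fourier_apply, Lp.toTemperedDistribution_apply,
    Lp.toTemperedDistribution_apply]
  have h1 : ∫ x, (𝓕 g) x • (hw2.toLp w) x = ∫ x, (𝓕 g) x • w x :=
    integral_congr_ae (by filter_upwards [hw2.coeFn_toLp] with x hx; rw [hx])
  have h2 : ∫ x, g x • (hw3.toLp (𝓕 w)) x = ∫ x, g x • (𝓕 w) x :=
    integral_congr_ae (by filter_upwards [hw3.coeFn_toLp] with x hx; rw [hx])
  rw [h1, h2]
  exact g.integral_fourier_smul_eq_of_integrable hw1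

/-- An integrable function whose Fourier transform vanishes is zero almost everywhere. -/
theorem ae_eq_zero_of_fourier_eq_zero {w : ℝ → ℂ} (hw : Integrable w) (h : 𝓕 w = 0) :
    w =ᵐ[volume] 0 := by
  have key : ∀ g : 𝓢(ℝ, ℂ), ∫ x, g x • w x = 0 := fun g => by
    have h1 : ∫ x, (𝓕 (𝓕⁻ g)) x • w x = ∫ x, (𝓕⁻ g) x • (𝓕 w) x :=
      (𝓕⁻ g).integral_fourier_smul_eq_of_integrable hw
    simpa [h] using h1
  apply ae_eq_zero_of_integral_contDiff_smul_eq_zero hw.locallyIntegrable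
  intro g g_smooth g_cpt
  have hg₁ : HasCompactSupport (Complex.ofRealCLM ∘ g) := g_cpt.comp_left rfl
  have hg₂ : ContDiff ℝ (⊤ : ℕ∞) (Complex.ofRealCLM ∘ g) := by fun_prop
  simpa using key (hg₁.toSchwartzMap hg₂)

/-! ### The Cauchy kernel and the Hardy projection. -/

theorem norm_inv_ofReal_sub_sq (z : ℂ) (y : ℝ) :
    ‖((y : ℂ) - z)⁻¹‖ ^ 2 = ((y - z.re) ^ 2 + z.im ^ 2)⁻¹ := by
  rw [norm_inv, inv_pow, ← Complex.normSq_eq_norm_sq, Complex.normSq_apply]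
  simp [sq]

theorem integrable_inv_sub_sq_add_sq (x : ℝ) {ε : ℝ} (hε : ε ≠ 0) :
    Integrable fun y : ℝ => ((y - x) ^ 2 + ε ^ 2)⁻¹ := by
  have h := (((integrable_inv_one_add_sq).comp_div hε).comp_sub_right x).const_mul (ε ^ 2)⁻¹
  refine h.congr (Eventually.of_forall fun y => ?_)
  simp only
  rw [← mul_inv, div_pow]
  congr 1
  field_simp
  ring

theorem memLp_inv_ofReal_sub {z : ℂ} (hz : z.im ≠ 0) :
    MemLp (fun y : ℝ => ((y : ℂ) - z)⁻¹) 2 := by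
  rw [memLp_two_iff_integrable_sq_norm
    (Measurable.aestronglyMeasurable (by fun_prop))]
  simp_rw [norm_inv_ofReal_sub_sq]
  exact integrable_inv_sub_sq_add_sq _ hz

theorem integrable_indicator_Ioi_exp {z : ℂ} (hz : 0 < z.im) :
    Integrable ((Ioi (0 : ℝ)).indicator
      fun ξ : ℝ => Complex.exp (2 * Real.pi * Complex.I * z * ξ)) := by
  rw [integrable_indicator_iff measurableSet_Ioi]
  refine integrableOn_exp_mul_complex_Ioi ?_ 0
  simp
  positivity

theorem integrable_indicator_Iic_exp {z : ℂ} (hz : z.im < 0) :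
    Integrable ((Iic (0 : ℝ)).indicator
      fun ξ : ℝ => Complex.exp (2 * Real.pi * Complex.I * z * ξ)) := by
  rw [integrable_indicator_iff measurableSet_Iic]
  refine integrableOn_exp_mul_complex_Iic ?_ 0
  simp
  exact mul_neg_of_pos_of_neg (by positivity) hz

/-- Squaring the modulus doubles `z`, so square integrability reduces to integrability. -/
theorem norm_indicator_exp_sq (s : Set ℝ) (z : ℂ) (ξ : ℝ) :
    ‖s.indicator (fun ξ : ℝ => Complex.exp (2 * Real.pi * Complex.I * z * ξ)) ξ‖ ^ 2 =
    ‖s.indicator (fun ξ : ℝ => Complex.exp (2 * Real.pi * Complex.I * (2 * z) * ξ)) ξ‖ := by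
  by_cases h : ξ ∈ s
  · simp only [indicator_of_mem h]
    rw [← norm_pow, ← Complex.exp_nat_mul]
    congr 2
    push_cast
    ring
  · simp [indicator_of_notMem h]

theorem memLp_indicator_Ioi_exp {z : ℂ} (hz : 0 < z.im) :
    MemLp ((Ioi (0 : ℝ)).indicator
      fun ξ : ℝ => Complex.exp (2 * Real.pi * Complex.I * z * ξ)) 2 := by
  rw [memLp_two_iff_integrable_sq_norm (integrable_indicator_Ioi_exp hz).1]
  simp_rw [norm_indicator_exp_sq]
  exact (integrable_indicator_Ioi_exp (by simpa using hz)).norm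

theorem memLp_indicator_Iic_exp {z : ℂ} (hz : z.im < 0) :
    MemLp ((Iic (0 : ℝ)).indicator
      fun ξ : ℝ => Complex.exp (2 * Real.pi * Complex.I * z * ξ)) 2 := by
  rw [memLp_two_iff_integrable_sq_norm (integrable_indicator_Iic_exp hz).1]
  simp_rw [norm_indicator_exp_sq]
  refine (integrable_indicator_Iic_exp ?_).norm
  simp
  linarith

theorem fourier_indicator_exp (s : Set ℝ) (hs : MeasurableSet s) (z : ℂ) (y : ℝ) :
    𝓕 (s.indicator fun ξ : ℝ => Complex.exp (2 * Real.pi * Complex.I * z * ξ)) y =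
      ∫ ξ in s, Complex.exp (2 * Real.pi * Complex.I * (z - y) * ξ) := by
  rw [Real.fourier_eq', ← integral_indicator hs]
  congr 1
  ext ξ
  by_cases h : ξ ∈ s
  · simp only [indicator_of_mem h, smul_eq_mul, ← Complex.exp_add]
    congr 1
    simp
    ring
  · simp [indicator_of_notMem h]

theorem fourier_indicator_Ioi_exp {z : ℂ} (hz : 0 < z.im) :
    𝓕 ((Ioi (0 : ℝ)).indicator fun ξ : ℝ => Complex.exp (2 * Real.pi * Complex.I * z * ξ)) =
      fun y : ℝ => (2 * Real.pi * Complex.I)⁻¹ * ((y : ℂ) - z)⁻¹ := by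
  ext y
  rw [fourier_indicator_exp _ measurableSet_Ioi, integral_exp_mul_complex_Ioi]
  · rw [← mul_inv, ← neg_sub z (y : ℂ), mul_neg, inv_neg]
    simp [neg_div]
  · simp
    positivity

theorem fourier_indicator_Iic_exp {z : ℂ} (hz : z.im < 0) :
    𝓕 ((Iic (0 : ℝ)).indicator fun ξ : ℝ => Complex.exp (2 * Real.pi * Complex.I * z * ξ)) =
      fun y : ℝ => -(2 * Real.pi * Complex.I)⁻¹ * ((y : ℂ) - z)⁻¹ := by
  ext y
  rw [fourier_indicator_exp _ measurableSet_Iic, integral_exp_mul_complex_Iic]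
  · rw [neg_mul, ← mul_inv, ← neg_sub z (y : ℂ), mul_neg, inv_neg]
    simp
  · simp
    exact mul_neg_of_pos_of_neg (by positivity) hz

theorem inner_toLp_eq_integral {w : ℝ → ℂ} (hw : MemLp w 2) (v : Lp ℂ 2 (volume : Measure ℝ)) :
    inner ℂ (hw.toLp w) v = ∫ x, starRingEnd ℂ (w x) * v x := by
  rw [L2.inner_def]
  refine integral_congr_ae ?_
  filter_upwards [hw.coeFn_toLp] with x hx
  rw [hx]
  simp [mul_comm]

/-- The Cauchy kernel is the transform of a one-sided exponential, so by Plancherel a Cauchy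
integral in the lower half-plane sees `v` only on `(0, ∞)`. The inner product conjugates its first
argument, whence the conjugate of `z`. -/
theorem integral_fourier_mul_inv_sub_of_pos {z : ℂ} (hz : 0 < z.im)
    (v : Lp ℂ 2 (volume : Measure ℝ)) :
    ∫ y : ℝ, (𝓕 v : Lp ℂ 2 (volume : Measure ℝ)) y * ((y : ℂ) - starRingEnd ℂ z)⁻¹ =
      -(2 * Real.pi * Complex.I) * ∫ ξ in Ioi (0 : ℝ),
        starRingEnd ℂ (Complex.exp (2 * Real.pi * Complex.I * z * ξ)) * v ξ := by
  have hF : MemLp (𝓕 ((Ioi (0 : ℝ)).indicator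
      fun ξ : ℝ => Complex.exp (2 * Real.pi * Complex.I * z * ξ))) 2 := by
    rw [fourier_indicator_Ioi_exp hz]
    exact (memLp_inv_ofReal_sub hz.ne').const_mul _
  have h := Lp.inner_fourier_eq ((memLp_indicator_Ioi_exp hz).toLp) v
  rw [MemLp.fourier_toLp (integrable_indicator_Ioi_exp hz) _ hF, inner_toLp_eq_integral,
    inner_toLp_eq_integral] at h
  rw [← integral_indicator measurableSet_Ioi]
  have h2 : ∀ ξ : ℝ, (Ioi (0 : ℝ)).indicator (fun ξ : ℝ =>
      starRingEnd ℂ (Complex.exp (2 * Real.pi * Complex.I * z * ξ)) * v ξ) ξ =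
      starRingEnd ℂ ((Ioi (0 : ℝ)).indicator
        (fun ξ : ℝ => Complex.exp (2 * Real.pi * Complex.I * z * ξ)) ξ) * v ξ := fun ξ => by
    by_cases h : ξ ∈ Ioi (0 : ℝ)
    · simp only [indicator_of_mem h]
    · simp [indicator_of_notMem h]
  simp_rw [h2]
  rw [← h, ← integral_const_mul]
  congr 1
  ext y
  rw [fourier_indicator_Ioi_exp hz]
  have : (2 * Real.pi * Complex.I : ℂ) ≠ 0 := by simp
  simp only [map_mul, map_inv₀, map_sub, Complex.conj_ofReal, Complex.conj_I, map_ofNat]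
  field_simp

theorem integral_fourier_mul_inv_sub_of_neg {z : ℂ} (hz : z.im < 0)
    (v : Lp ℂ 2 (volume : Measure ℝ)) :
    ∫ y : ℝ, (𝓕 v : Lp ℂ 2 (volume : Measure ℝ)) y * ((y : ℂ) - starRingEnd ℂ z)⁻¹ =
      (2 * Real.pi * Complex.I) * ∫ ξ in Iic (0 : ℝ),
        starRingEnd ℂ (Complex.exp (2 * Real.pi * Complex.I * z * ξ)) * v ξ := by
  have hF : MemLp (𝓕 ((Iic (0 : ℝ)).indicator
      fun ξ : ℝ => Complex.exp (2 * Real.pi * Complex.I * z * ξ))) 2 := by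
    rw [fourier_indicator_Iic_exp hz]
    exact (memLp_inv_ofReal_sub hz.ne).const_mul _
  have h := Lp.inner_fourier_eq ((memLp_indicator_Iic_exp hz).toLp) v
  rw [MemLp.fourier_toLp (integrable_indicator_Iic_exp hz) _ hF, inner_toLp_eq_integral,
    inner_toLp_eq_integral] at h
  rw [← integral_indicator measurableSet_Iic]
  have h2 : ∀ ξ : ℝ, (Iic (0 : ℝ)).indicator (fun ξ : ℝ =>
      starRingEnd ℂ (Complex.exp (2 * Real.pi * Complex.I * z * ξ)) * v ξ) ξ =
      starRingEnd ℂ ((Iic (0 : ℝ)).indicator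
        (fun ξ : ℝ => Complex.exp (2 * Real.pi * Complex.I * z * ξ)) ξ) * v ξ := fun ξ => by
    by_cases h : ξ ∈ Iic (0 : ℝ)
    · simp only [indicator_of_mem h]
    · simp [indicator_of_notMem h]
  simp_rw [h2]
  rw [← h, ← integral_const_mul]
  congr 1
  ext y
  rw [fourier_indicator_Iic_exp hz]
  have : (2 * Real.pi * Complex.I : ℂ) ≠ 0 := by simp
  simp only [map_mul, map_inv₀, map_sub, map_neg, Complex.conj_ofReal, Complex.conj_I, map_ofNat]
  field_simp

/-- The projection to the Hardy space of the lower half-plane. -/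
theorem exists_hardy_projection {u : ℝ → ℂ} (hu : MemLp u 2) :
    ∃ h : ℝ → ℂ, MemLp h 2 ∧ ∀ z : ℂ, 0 < z.im →
      ∫ y : ℝ, u y * ((y : ℂ) - starRingEnd ℂ z)⁻¹ = ∫ y : ℝ, h y * ((y : ℂ) - starRingEnd ℂ z)⁻¹ ∧
      ∫ y : ℝ, h y * ((y : ℂ) - z)⁻¹ = 0 := by
  set U : Lp ℂ 2 (volume : Measure ℝ) := 𝓕⁻ (hu.toLp u)
  have hU : 𝓕 U = hu.toLp u := FourierTransform.fourier_fourierInv_eq _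
  have hV := (Lp.memLp U).indicator (measurableSet_Ioi (a := (0 : ℝ)))
  -- The projection is `h = 𝓕 (1_{(0,∞)} 𝓕⁻¹ u)`: Cauchy integrals in the lower half-plane are
  -- unchanged, while those in the upper half-plane see only `(-∞, 0]`, where nothing is left.
  refine ⟨(𝓕 (hV.toLp) : Lp ℂ 2 (volume : Measure ℝ)), Lp.memLp _, fun z hz => ⟨?_, ?_⟩⟩
  · have h1 : ∫ y : ℝ, u y * ((y : ℂ) - starRingEnd ℂ z)⁻¹ =
        ∫ y : ℝ, (𝓕 U : Lp ℂ 2 (volume : Measure ℝ)) y * ((y : ℂ) - starRingEnd ℂ z)⁻¹ := by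
      rw [hU]
      refine integral_congr_ae ?_
      filter_upwards [hu.coeFn_toLp] with y hy
      rw [hy]
    rw [h1, integral_fourier_mul_inv_sub_of_pos hz, integral_fourier_mul_inv_sub_of_pos hz]
    congr 1
    refine setIntegral_congr_ae measurableSet_Ioi ?_
    filter_upwards [hV.coeFn_toLp] with y hy hy0
    rw [hy, indicator_of_mem hy0]
  · have h1 := integral_fourier_mul_inv_sub_of_neg (z := starRingEnd ℂ z) (by simpa using hz)
      (hV.toLp)
    rw [Complex.conj_conj] at h1
    rw [h1, setIntegral_congr_ae (g := fun _ => 0) measurableSet_Iic]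
    · simp
    · filter_upwards [hV.coeFn_toLp] with y hy hy0
      rw [hy, indicator_of_notMem (by simpa using hy0), mul_zero]

/-! ### The Poisson kernel and boundary values of Cauchy integrals. -/

theorem inv_sub_sub_inv_sub_conj (x y : ℝ) {ε : ℝ} (hε : ε ≠ 0) :
    ((y : ℂ) - (x + Complex.I * ε))⁻¹ - ((y : ℂ) - (x - Complex.I * ε))⁻¹ =
      2 * Complex.I * ((ε * ((y - x) ^ 2 + ε ^ 2)⁻¹ : ℝ) : ℂ) := by
  have h1 : (y : ℂ) - (x + Complex.I * ε) ≠ 0 := fun h => hε (by simpa using congrArg Complex.im h)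
  have h2 : (y : ℂ) - (x - Complex.I * ε) ≠ 0 := fun h => hε (by simpa using congrArg Complex.im h)
  have h3 : ((y : ℂ) - x) ^ 2 + ε ^ 2 =
      ((y : ℂ) - (x + Complex.I * ε)) * ((y : ℂ) - (x - Complex.I * ε)) := by
    linear_combination (ε ^ 2 : ℂ) * Complex.I_sq
  push_cast
  rw [h3]
  field_simp
  ring

theorem integral_mul_inv_sq_add_sq (x : ℝ) {ε : ℝ} (hε : 0 < ε) :
    ∫ y : ℝ, ε * ((y - x) ^ 2 + ε ^ 2)⁻¹ = Real.pi := by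
  have h : ∀ y : ℝ, ε * ((y - x) ^ 2 + ε ^ 2)⁻¹ = ε⁻¹ * (1 + ((y - x) / ε) ^ 2)⁻¹ := fun y => by
    field_simp
    ring
  simp_rw [h]
  rw [integral_const_mul, integral_sub_right_eq_self (fun y => (1 + (y / ε) ^ 2)⁻¹) x,
    Measure.integral_comp_div (fun y => (1 + y ^ 2)⁻¹) ε, integral_univ_inv_one_add_sq,
    abs_of_pos hε, smul_eq_mul]
  field_simp

theorem MeasureTheory.MemLp.integrable_mul_inv_ofReal_sub {h : ℝ → ℂ} (hh : MemLp h 2) {z : ℂ}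
    (hz : z.im ≠ 0) : Integrable fun y : ℝ => h y * ((y : ℂ) - z)⁻¹ :=
  hh.integrable_mul (memLp_inv_ofReal_sub hz)

theorem MeasureTheory.MemLp.integrable_mul_poissonKernel {h : ℝ → ℂ} (hh : MemLp h 2) (x : ℝ)
    {ε : ℝ} (hε : ε ≠ 0) :
    Integrable fun y : ℝ => h y * ((ε * ((y - x) ^ 2 + ε ^ 2)⁻¹ : ℝ) : ℂ) := by
  have h1 := hh.integrable_mul_inv_ofReal_sub (z := x + Complex.I * ε) (by simpa using hε)
  have h2 := hh.integrable_mul_inv_ofReal_sub (z := x - Complex.I * ε) (by simpa using hε)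
  refine ((h1.sub h2).const_mul (2 * Complex.I)⁻¹).congr (Eventually.of_forall fun y => ?_)
  have := inv_sub_sub_inv_sub_conj x y hε
  simp only [Pi.sub_apply]
  rw [← mul_sub, this]
  field_simp

theorem integrable_ofReal_poissonKernel (x : ℝ) {ε : ℝ} (hε : ε ≠ 0) :
    Integrable fun y : ℝ => ((ε * ((y - x) ^ 2 + ε ^ 2)⁻¹ : ℝ) : ℂ) :=
  ((integrable_inv_sub_sq_add_sq x hε).const_mul ε).ofReal

theorem integrable_norm_sub_mul_poissonKernel {h : ℝ → ℂ} (hh : MemLp h 2) (x : ℝ) (c : ℂ)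
    {ε : ℝ} (hε : 0 < ε) :
    Integrable fun y : ℝ => ‖h y - c‖ * (ε * ((y - x) ^ 2 + ε ^ 2)⁻¹) := by
  refine ((hh.integrable_mul_poissonKernel x hε.ne').sub
    ((integrable_ofReal_poissonKernel x hε.ne').const_mul c)).norm.congr
    (Eventually.of_forall fun y => ?_)
  simp only [Pi.sub_apply]
  have : 0 ≤ ε * ((y - x) ^ 2 + ε ^ 2)⁻¹ := by positivity
  rw [← sub_mul, norm_mul, Complex.norm_real, Real.norm_of_nonneg this]

/-- Dyadic domination of the Poisson kernel. -/
theorem poissonKernel_le_dyadic (x y : ℝ) {ε : ℝ} (hε : 0 < ε) :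
    ∃ k : ℕ, y ∈ Metric.closedBall x (2 ^ k * ε) ∧
      ε * ((y - x) ^ 2 + ε ^ 2)⁻¹ ≤ 4 / ε * (1 / 4) ^ k := by
  have hex : ∃ k : ℕ, |y - x| ≤ 2 ^ k * ε := by
    obtain ⟨k, hk⟩ := pow_unbounded_of_one_lt (|y - x| / ε) one_lt_two
    exact ⟨k, ((div_lt_iff₀ hε).1 hk).le⟩
  classical
  -- For the least such `k`, if positive, `|y - x| > 2^(k-1) ε`, so the kernel is below `4^(1-k) /
  -- ε`.
  refine ⟨Nat.find hex, by simpa [Real.dist_eq] using Nat.find_spec hex, ?_⟩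
  rcases hk : Nat.find hex with _ | k
  · rw [pow_zero, mul_one, ← div_eq_mul_inv, div_le_div_iff₀ (by positivity) hε]
    nlinarith [sq_nonneg (y - x)]
  · have := Nat.find_min hex (m := k) (by omega)
    rw [not_le] at this
    have h2 : (2 ^ k * ε) ^ 2 ≤ (y - x) ^ 2 := by
      rw [← sq_abs (y - x)]
      gcongr
    have h4 : ((2 : ℝ) ^ k) ^ 2 = 4 ^ k := by rw [← pow_mul, mul_comm, pow_mul]; norm_num
    rw [mul_pow, h4] at h2
    rw [one_div, inv_pow, ← div_eq_mul_inv, ← div_eq_mul_inv, div_div,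
      div_le_div_iff₀ (by positivity) (by positivity), pow_succ]
    nlinarith [sq_nonneg ε]

/-- The dyadic ball of radius `2^k ε`, cut to radius `r`, carries mass at most `δ 2^k ε`, even when
it is larger than `r`. Weighted by `4 · 4^(-k) / ε` this is `4δ 2^(-k)`, with sum `8δ`. -/
theorem lintegral_closedBall_mul_poissonKernel_le {A : ℝ → ENNReal} (hA : AEMeasurable A) {x δ r : ℝ}
    (hδ : 0 ≤ δ) (hr : 0 < r)
    (hΦ : ∀ s ∈ Ioc 0 r, ∫⁻ y in Metric.closedBall x s, A y ≤ ENNReal.ofReal (δ * s))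
    {ε : ℝ} (hε : 0 < ε) :
    ∫⁻ y in Metric.closedBall x r, A y * ENNReal.ofReal (ε * ((y - x) ^ 2 + ε ^ 2)⁻¹) ≤
      ENNReal.ofReal (8 * δ) := by
  calc _ ≤ ∫⁻ y in Metric.closedBall x r, ∑' k : ℕ, ENNReal.ofReal (4 / ε * (1 / 4) ^ k) *
          (Metric.closedBall x (2 ^ k * ε)).indicator A y := by
        refine lintegral_mono fun y => ?_
        obtain ⟨k, hk, hle⟩ := poissonKernel_le_dyadic x y hε
        refine le_trans ?_ (ENNReal.le_tsum k)
        rw [indicator_of_mem hk, mul_comm]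
        gcongr
    _ = ∑' k : ℕ, ENNReal.ofReal (4 / ε * (1 / 4) ^ k) *
          ∫⁻ y in Metric.closedBall x r, (Metric.closedBall x (2 ^ k * ε)).indicator A y := by
        rw [lintegral_tsum]
        · congr 1
          ext k
          rw [lintegral_const_mul'' _ (hA.restrict.indicator Metric.isClosed_closedBall.measurableSet)]
        · exact fun k => (hA.restrict.indicator Metric.isClosed_closedBall.measurableSet).const_mul _
    _ ≤ ∑' k : ℕ, ENNReal.ofReal (4 / ε * (1 / 4) ^ k) * ENNReal.ofReal (δ * (2 ^ k * ε)) := by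
        refine ENNReal.tsum_le_tsum fun k => ?_
        gcongr
        rw [lintegral_indicator Metric.isClosed_closedBall.measurableSet,
          Measure.restrict_restrict Metric.isClosed_closedBall.measurableSet]
        rcases le_total (2 ^ k * ε) r with h | h
        · exact (lintegral_mono_set inter_subset_left).trans (hΦ _ ⟨by positivity, h⟩)
        · refine (lintegral_mono_set inter_subset_right).trans ((hΦ r ⟨hr, le_rfl⟩).trans ?_)
          gcongr
    _ = ∑' k : ℕ, ENNReal.ofReal (4 * δ * (1 / 2) ^ k) := by
        congr 1
        ext k
        rw [← ENNReal.ofReal_mul (by positivity)]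
        congr 1
        rw [show (1 / 4 : ℝ) = 1 / 2 * (1 / 2) by norm_num, mul_pow]
        have : (1 / 2 : ℝ) ^ k * 2 ^ k = 1 := by rw [← mul_pow]; norm_num
        field_simp
        linear_combination δ * this
    _ = ENNReal.ofReal (8 * δ) := by
        rw [← ENNReal.ofReal_tsum_of_nonneg (fun k => by positivity)
          (summable_geometric_two.mul_left _), tsum_mul_left, tsum_geometric_two]
        congr 1
        ring

/-- Convergence holds at every Lebesgue point `x`: the kernel has mass `π`, the contribution near
`x` is controlled by small averages of `‖h y - h x‖`, and the rest is `O(ε)`. -/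
theorem tendsto_integral_mul_poissonKernel_ae {h : ℝ → ℂ} (hh : MemLp h 2) :
    ∀ᵐ x : ℝ, Tendsto (fun ε : ℝ => ∫ y : ℝ, h y * ((ε * ((y - x) ^ 2 + ε ^ 2)⁻¹ : ℝ) : ℂ))
      (𝓝[>] 0) (𝓝 (Real.pi * h x)) := by
  have hloc : LocallyIntegrable h := hh.locallyIntegrable (by norm_num)
  filter_upwards [IsUnifLocDoublingMeasure.ae_tendsto_average_norm_sub volume hloc 1] with x hx
  have hx0 := hx (l := 𝓝[>] (0 : ℝ)) (fun _ => x) id tendsto_id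
    (by filter_upwards [self_mem_nhdsWithin] with s hs
        exact Metric.mem_closedBall_self (by simpa using le_of_lt hs))
  rw [Metric.tendsto_nhds]
  intro e he
  -- An average below `e/32` over a ball of length `2s` gives mass at most `(e/16) s`, hence a near
  -- part at most `8 · e/16 = e/2`; the far part gets `e/4`.
  have hη : 0 < e / 32 := by positivity
  obtain ⟨r, hr, hav⟩ : ∃ r : ℝ, 0 < r ∧ ∀ s ∈ Ioc 0 r,
      ⨍ y in Metric.closedBall x s, ‖h y - h x‖ < e / 32 := by
    have := (tendsto_order.1 hx0).2 _ hη
    obtain ⟨r, hr, hsub⟩ := mem_nhdsGT_iff_exists_Ioc_subset.1 this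
    exact ⟨r, hr, fun s hs => hsub hs⟩
  set A : ℝ → ℝ := fun y => ‖h y - h x‖
  have hAmeas : AEStronglyMeasurable A volume := (hh.1.sub aestronglyMeasurable_const).norm
  have hΦ : ∀ s ∈ Ioc 0 r, ∫⁻ y in Metric.closedBall x s, ENNReal.ofReal (A y) ≤
      ENNReal.ofReal (e / 16 * s) := by
    intro s hs
    have hint : IntegrableOn A (Metric.closedBall x s) :=
      ((hloc.integrableOn_isCompact (isCompact_closedBall x s)).sub
        (integrableOn_const (by simp [ENNReal.mul_eq_top]))).norm
    rw [← ofReal_integral_eq_lintegral_ofReal hint (Eventually.of_forall fun y => norm_nonneg _)]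
    refine ENNReal.ofReal_le_ofReal ?_
    have h1 := (hav s hs).le
    rw [setAverage_eq, smul_eq_mul, Real.volume_real_closedBall hs.1.le,
      inv_mul_le_iff₀ (by have := hs.1; positivity)] at h1
    linarith
  set C := ∫ y : ℝ, A y * (1 * ((y - x) ^ 2 + 1 ^ 2)⁻¹)
  have hev : ∀ᶠ ε : ℝ in 𝓝[>] 0, ε * ((1 + (r ^ 2)⁻¹) * C) < e / 4 := by
    have ht : Tendsto (fun ε : ℝ => ε * ((1 + (r ^ 2)⁻¹) * C)) (𝓝[>] 0) (𝓝 0) := by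
      have := (tendsto_id (α := ℝ) (x := 𝓝 0)).mul_const ((1 + (r ^ 2)⁻¹) * C)
      rw [zero_mul] at this
      exact this.mono_left nhdsWithin_le_nhds
    exact (tendsto_order.1 ht).2 _ (by positivity)
  filter_upwards [hev, self_mem_nhdsWithin] with ε hε2 hε
  have hε : 0 < ε := hε
  have hint := integrable_norm_sub_mul_poissonKernel hh x (h x) hε
  have hnear : ∫ y in Metric.closedBall x r, A y * (ε * ((y - x) ^ 2 + ε ^ 2)⁻¹) ≤ e / 2 := by
    have h1 := lintegral_closedBall_mul_poissonKernel_le (A := fun y => ENNReal.ofReal (A y))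
      hAmeas.aemeasurable.ennreal_ofReal (by positivity) hr hΦ hε
    have h2 : ∀ y : ℝ, ENNReal.ofReal (A y) * ENNReal.ofReal (ε * ((y - x) ^ 2 + ε ^ 2)⁻¹) =
        ENNReal.ofReal (A y * (ε * ((y - x) ^ 2 + ε ^ 2)⁻¹)) := fun y =>
      (ENNReal.ofReal_mul (norm_nonneg _)).symm
    simp_rw [h2] at h1
    rw [← ofReal_integral_eq_lintegral_ofReal hint.integrableOn
      (Eventually.of_forall fun y => mul_nonneg (norm_nonneg _) (by positivity))] at h1
    have h3 := (ENNReal.ofReal_le_ofReal_iff (by positivity)).1 h1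
    linarith
  have hfar : ∫ y in (Metric.closedBall x r)ᶜ, A y * (ε * ((y - x) ^ 2 + ε ^ 2)⁻¹) ≤
      ε * ((1 + (r ^ 2)⁻¹) * C) := by
    have hint1 := integrable_norm_sub_mul_poissonKernel hh x (h x) one_pos
    calc _ ≤ ∫ y in (Metric.closedBall x r)ᶜ,
          ε * (1 + (r ^ 2)⁻¹) * (A y * (1 * ((y - x) ^ 2 + 1 ^ 2)⁻¹)) := by
          refine setIntegral_mono_on hint.integrableOn (hint1.const_mul _).integrableOn
            Metric.isClosed_closedBall.measurableSet.compl fun y hy => ?_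
          have hy : r ^ 2 < (y - x) ^ 2 := by
            rw [mem_compl_iff, Metric.mem_closedBall, Real.dist_eq, not_le] at hy
            rw [← sq_abs (y - x)]
            gcongr
          have hA0 : 0 ≤ A y := norm_nonneg _
          -- Away from `x` the kernel is dominated by a multiple of `ε` times the kernel with
          -- parameter `1`, which is integrable against `A`.
          have key : ((y - x) ^ 2 + ε ^ 2)⁻¹ ≤ (1 + (r ^ 2)⁻¹) * ((y - x) ^ 2 + 1 ^ 2)⁻¹ := by
            rw [← div_eq_mul_inv, le_div_iff₀ (by positivity), inv_mul_le_iff₀ (by positivity)]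
            have : 1 ≤ (y - x) ^ 2 * (r ^ 2)⁻¹ := by
              rw [← div_eq_mul_inv, le_div_iff₀ (by positivity)]
              linarith
            have h5 : 0 ≤ ε ^ 2 * (r ^ 2)⁻¹ := by positivity
            nlinarith [sq_nonneg ε]
          calc A y * (ε * ((y - x) ^ 2 + ε ^ 2)⁻¹)
              ≤ A y * (ε * ((1 + (r ^ 2)⁻¹) * ((y - x) ^ 2 + 1 ^ 2)⁻¹)) := by gcongr
            _ = _ := by ring
      _ = ε * (1 + (r ^ 2)⁻¹) * ∫ y in (Metric.closedBall x r)ᶜ,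
            (A y * (1 * ((y - x) ^ 2 + 1 ^ 2)⁻¹)) := integral_const_mul _ _
      _ ≤ ε * (1 + (r ^ 2)⁻¹) * C := by
          gcongr
          exact setIntegral_le_integral hint1
            (Eventually.of_forall fun y => mul_nonneg (norm_nonneg _) (by positivity))
      _ = _ := by ring
  have hsplit := integral_add_compl
    (Metric.isClosed_closedBall (x := x) (ε := r)).measurableSet hint
  have hc : (Real.pi * h x : ℂ) =
      ∫ y : ℝ, h x * ((ε * ((y - x) ^ 2 + ε ^ 2)⁻¹ : ℝ) : ℂ) := by
    rw [integral_const_mul, integral_complex_ofReal, integral_mul_inv_sq_add_sq x hε, mul_comm]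
  rw [dist_eq_norm, hc, ← integral_sub (hh.integrable_mul_poissonKernel x hε.ne')
    ((integrable_ofReal_poissonKernel x hε.ne').const_mul (h x))]
  refine (norm_integral_le_integral_norm _).trans_lt ?_
  have heq : ∀ y : ℝ, ‖h y * ((ε * ((y - x) ^ 2 + ε ^ 2)⁻¹ : ℝ) : ℂ) -
      h x * ((ε * ((y - x) ^ 2 + ε ^ 2)⁻¹ : ℝ) : ℂ)‖ = A y * (ε * ((y - x) ^ 2 + ε ^ 2)⁻¹) :=
    fun y => by
      rw [← sub_mul, norm_mul, Complex.norm_real, Real.norm_of_nonneg (by positivity)]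
  simp_rw [heq]
  rw [← hsplit]
  linarith

/-- The Cauchy integral of a function in `L²(ℝ)` has boundary values from both sides almost
everywhere, and their difference is the function. -/
theorem exists_tendsto_cauchyIntegral_ae {u : ℝ → ℂ} (hu : MemLp u 2) :
    ∀ᵐ x : ℝ, ∃ fp fm : ℂ,
      Tendsto (fun ε : ℝ => ∫ y : ℝ, u y * ((y : ℂ) - (x + Complex.I * ε))⁻¹) (𝓝[>] 0) (𝓝 fp) ∧
      Tendsto (fun ε : ℝ => ∫ y : ℝ, u y * ((y : ℂ) - (x - Complex.I * ε))⁻¹) (𝓝[>] 0) (𝓝 fm) ∧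
      fp - fm = 2 * Real.pi * Complex.I * u x := by
  obtain ⟨h, hh, hproj⟩ := exists_hardy_projection hu
  have key : ∀ (v : ℝ → ℂ), MemLp v 2 → ∀ x ε : ℝ, 0 < ε →
      (∫ y : ℝ, v y * ((y : ℂ) - (x + Complex.I * ε))⁻¹) -
        ∫ y : ℝ, v y * ((y : ℂ) - (x - Complex.I * ε))⁻¹ =
      2 * Complex.I * ∫ y : ℝ, v y * ((ε * ((y - x) ^ 2 + ε ^ 2)⁻¹ : ℝ) : ℂ) := by
    intro v hv x ε hε
    rw [← integral_sub (hv.integrable_mul_inv_ofReal_sub (by simpa using hε.ne'))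
      (hv.integrable_mul_inv_ofReal_sub (by simpa using hε.ne')), ← integral_const_mul]
    congr 1
    ext y
    rw [← mul_sub, inv_sub_sub_inv_sub_conj x y hε.ne']
    ring
  filter_upwards [tendsto_integral_mul_poissonKernel_ae hu,
    tendsto_integral_mul_poissonKernel_ae hh] with x hux hhx
  have hconj : ∀ ε : ℝ, starRingEnd ℂ ((x : ℂ) + Complex.I * ε) = x - Complex.I * ε := fun ε => by
    simp [sub_eq_add_neg]
  -- From below, `u` may be replaced by `h`; the Cauchy integral of `h` from above is zero, so the
  -- one from below is minus a Poisson integral of `h`.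
  have hm : Tendsto (fun ε : ℝ => ∫ y : ℝ, u y * ((y : ℂ) - (x - Complex.I * ε))⁻¹) (𝓝[>] 0)
      (𝓝 (-(2 * Complex.I * (Real.pi * h x)))) := by
    refine (hhx.const_mul (2 * Complex.I)).neg.congr' ?_
    filter_upwards [self_mem_nhdsWithin] with ε hε
    have hε : 0 < ε := hε
    obtain ⟨h1, h2⟩ := hproj (x + Complex.I * ε) (by simpa using hε)
    rw [hconj] at h1
    rw [h1, ← key h hh x ε hε, h2, zero_sub, neg_neg]
  refine ⟨2 * Complex.I * (Real.pi * u x) + -(2 * Complex.I * (Real.pi * h x)), _, ?_, hm, ?_⟩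
  · refine ((hux.const_mul (2 * Complex.I)).add hm).congr' ?_
    filter_upwards [self_mem_nhdsWithin] with ε hε
    rw [← key u hu x ε hε]
    ring
  · ring

/-! ### Laguerre functions as an orthonormal basis of `L²(0,∞)`. -/

/-- Up to the sign `(-1)^n`, the sum is the `n`-th difference at `0` of `l ↦ C(l,i)`. -/
theorem sum_alternating_choose_mul_choose (n i : ℕ) :
    ∑ l ∈ Finset.range (n + 1), (-1 : ℝ) ^ l * n.choose l * l.choose i =
      if n = i then (-1) ^ n else 0 := by
  have h := fwdDiff_iter_choose_zero i n
  rw [fwdDiff_iter_eq_sum_shift] at h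
  have h2 : ∑ l ∈ Finset.range (n + 1), (-1 : ℤ) ^ l * n.choose l * l.choose i =
      (-1) ^ n * if n = i then 1 else 0 := by
    rw [← h, Finset.mul_sum]
    refine Finset.sum_congr rfl fun l hl => ?_
    have hl := Finset.mem_range.1 hl
    obtain ⟨d, rfl⟩ := Nat.exists_eq_add_of_le (Nat.lt_succ_iff.1 hl)
    have : (-1 : ℤ) ^ (l + d) * (-1) ^ d = (-1) ^ l := by
      rw [pow_add, mul_assoc, ← mul_pow]; simp
    simp only [smul_eq_mul, zero_add, mul_one, Nat.add_sub_cancel_left]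
    rw [← this]
    ring
  have h3 := congrArg (Int.cast : ℤ → ℝ) h2
  push_cast at h3
  rw [h3]
  split_ifs <;> simp

theorem add_choose_eq_sum_choose_mul_choose (k l N : ℕ) (hk : k < N) :
    (k + l).choose k = ∑ i ∈ Finset.range N, k.choose i * l.choose i := by
  rw [Nat.add_choose_eq, Finset.Nat.sum_antidiagonal_eq_sum_range_succ
    (fun i j => k.choose i * l.choose j), ← Finset.sum_range_reflect]
  rw [← Finset.sum_subset (Finset.range_subset_range.2 hk)]
  · refine Finset.sum_congr rfl fun i hi => ?_
    have hi := Finset.mem_range.1 hi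
    rw [show k + 1 - 1 - i = k - i by omega, Nat.choose_symm (by omega),
      Nat.sub_sub_self (by omega)]
  · intro i _ hi
    rw [Nat.choose_eq_zero_of_lt (by simpa using hi), zero_mul]

/-- This is Laguerre orthogonality after termwise integration, since `(k+l)!/(k! l!) = C(k+l,k)`.
Vandermonde separates `k` from `l`, and the alternating sums leave only `i = m` and `i = n`. -/
theorem sum_sum_alternating_choose (m n : ℕ) :
    ∑ k ∈ Finset.range (m + 1), ∑ l ∈ Finset.range (n + 1),
      (-1 : ℝ) ^ k * m.choose k * ((-1) ^ l * n.choose l) * (k + l).choose k =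
      if m = n then 1 else 0 := by
  have h : ∀ k ∈ Finset.range (m + 1), ∑ l ∈ Finset.range (n + 1),
      (-1 : ℝ) ^ k * m.choose k * ((-1) ^ l * n.choose l) * (k + l).choose k =
      ∑ i ∈ Finset.range (m + 1), ((-1 : ℝ) ^ k * m.choose k * k.choose i) *
        (if n = i then (-1) ^ n else 0) := by
    intro k hk
    simp_rw [← sum_alternating_choose_mul_choose, Finset.mul_sum]
    rw [Finset.sum_comm]
    refine Finset.sum_congr rfl fun l _ => ?_
    rw [add_choose_eq_sum_choose_mul_choose k l (m + 1) (Finset.mem_range.1 hk)]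
    push_cast
    rw [Finset.mul_sum]
    exact Finset.sum_congr rfl fun i _ => by ring
  rw [Finset.sum_congr rfl h, Finset.sum_comm]
  simp_rw [← Finset.sum_mul, sum_alternating_choose_mul_choose]
  by_cases hmn : m = n
  · subst hmn
    rw [Finset.sum_eq_single m]
    · simp [← mul_pow]
    · intro b _ hb
      simp [hb.symm]
    · simp
  · rw [if_neg hmn]
    refine Finset.sum_eq_zero fun i _ => ?_
    split_ifs with h1 h2
    · exact absurd (h1.trans h2.symm) hmn
    all_goals simp

theorem integrableOn_pow_mul_exp_neg_mul (k : ℕ) {b : ℝ} (hb : 0 < b) :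
    IntegrableOn (fun t : ℝ => t ^ k * Real.exp (-(b * t))) (Ioi 0) := by
  have h := integrableOn_rpow_mul_exp_neg_mul_rpow (s := k) (p := 1) (b := b)
    (by have := Nat.cast_nonneg (α := ℝ) k; linarith) one_pos hb
  simpa using h

theorem integral_pow_mul_exp_neg_two_mul (k : ℕ) :
    ∫ t in Ioi (0 : ℝ), t ^ k * Real.exp (-(2 * t)) = k.factorial / 2 ^ (k + 1) := by
  have h := Real.integral_rpow_mul_exp_neg_mul_Ioi (a := k + 1) (r := 2) (by positivity) two_pos
  rw [Real.Gamma_nat_eq_factorial] at h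
  simp only [add_sub_cancel_right, Real.rpow_natCast] at h
  rw [h, one_div, Real.inv_rpow two_pos.le, ← div_eq_inv_mul]
  norm_cast

theorem memLp_pow_mul_exp_neg_mul (k : ℕ) {b : ℝ} (hb : 0 < b) :
    MemLp (fun t : ℝ => t ^ k * Real.exp (-(b * t))) 2 (volume.restrict (Ioi 0)) := by
  rw [memLp_two_iff_integrable_sq (Continuous.aestronglyMeasurable (by fun_prop))]
  refine (integrableOn_pow_mul_exp_neg_mul (2 * k) (b := 2 * b) (by positivity)).congr
    (Eventually.of_forall fun t => ?_)
  simp only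
  rw [mul_pow, ← Real.exp_nat_mul]
  push_cast
  ring_nf

/-- The Laguerre function `√2 L_m(2t) e^{-t}`. -/
noncomputable def laguerreFun (m : ℕ) (t : ℝ) : ℝ :=
  Real.sqrt 2 * laguerrePoly m (2 * t) * Real.exp (-t)

theorem laguerreFun_eq_sum (m : ℕ) (t : ℝ) :
    laguerreFun m t = ∑ k ∈ Finset.range (m + 1),
      (Real.sqrt 2 * (m.choose k * (-2) ^ k / k.factorial)) * (t ^ k * Real.exp (-(1 * t))) := by
  rw [laguerreFun, laguerrePoly, Finset.mul_sum, Finset.sum_mul]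
  refine Finset.sum_congr rfl fun k _ => ?_
  rw [show -(2 * t) = (-2) * t by ring, mul_pow, one_mul]
  ring

theorem memLp_laguerreFun (m : ℕ) : MemLp (laguerreFun m) 2 (volume.restrict (Ioi 0)) := by
  rw [show laguerreFun m = _ from funext (laguerreFun_eq_sum m)]
  exact memLp_finsetSum _ fun k _ => (memLp_pow_mul_exp_neg_mul k one_pos).const_mul _

theorem integral_laguerreFun_mul (m n : ℕ) :
    ∫ t in Ioi (0 : ℝ), laguerreFun m t * laguerreFun n t = if m = n then 1 else 0 := by
  have h : ∀ t : ℝ, laguerreFun m t * laguerreFun n t =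
      ∑ k ∈ Finset.range (m + 1), ∑ l ∈ Finset.range (n + 1),
        (2 * (m.choose k * (-2) ^ k / k.factorial) * (n.choose l * (-2) ^ l / l.factorial)) *
          (t ^ (k + l) * Real.exp (-(2 * t))) := fun t => by
    rw [laguerreFun_eq_sum, laguerreFun_eq_sum, Finset.sum_mul_sum]
    refine Finset.sum_congr rfl fun k _ => Finset.sum_congr rfl fun l _ => ?_
    have h2 : Real.sqrt 2 * Real.sqrt 2 = 2 := Real.mul_self_sqrt (by norm_num)
    have he : Real.exp (-(2 * t)) = Real.exp (-(1 * t)) * Real.exp (-(1 * t)) := by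
      rw [← Real.exp_add]; ring_nf
    rw [he, pow_add]
    linear_combination ((m.choose k * (-2) ^ k / k.factorial) * (n.choose l * (-2) ^ l / l.factorial)
      * t ^ k * t ^ l * Real.exp (-(1 * t)) * Real.exp (-(1 * t))) * h2
  simp_rw [h]
  rw [integral_finsetSum _ fun k _ => integrable_finsetSum _ fun l _ =>
    (integrableOn_pow_mul_exp_neg_mul (k + l) two_pos).const_mul _]
  rw [← sum_sum_alternating_choose]
  refine Finset.sum_congr rfl fun k _ => ?_
  rw [integral_finsetSum _ fun l _ =>
    (integrableOn_pow_mul_exp_neg_mul (k + l) two_pos).const_mul _]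
  refine Finset.sum_congr rfl fun l _ => ?_
  rw [integral_const_mul, integral_pow_mul_exp_neg_two_mul,
    ← Nat.add_choose_mul_factorial_mul_factorial k l]
  push_cast
  rw [show (-2 : ℝ) = (-1) * 2 by norm_num, mul_pow, mul_pow, pow_succ, pow_add]
  field_simp
  rw [Nat.choose_symm_add]

theorem integrable_pow_mul_exp_mul {r : ℝ → ℂ} (hr : MemLp r 2 (volume.restrict (Ioi 0)))
    (k : ℕ) {b : ℝ} (hb : 0 < b) :
    IntegrableOn (fun t : ℝ => t ^ k * Real.exp (-(b * t)) * ‖r t‖) (Ioi 0) :=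
  (memLp_pow_mul_exp_neg_mul k hb).integrable_mul hr.norm

theorem norm_exp_neg_mul_ofReal (c : ℂ) (t : ℝ) :
    ‖Complex.exp (-(c * t))‖ = Real.exp (-(c.re * t)) := by
  rw [Complex.norm_exp]; simp

theorem differentiableOn_laplace {r : ℝ → ℂ} (hr : MemLp r 2 (volume.restrict (Ioi 0))) :
    DifferentiableOn ℂ (fun c : ℂ => ∫ t in Ioi (0 : ℝ), Complex.exp (-(c * t)) * r t)
      {c : ℂ | 0 < c.re} := by
  intro c₀ hc₀
  have hc₀ : 0 < c₀.re := hc₀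
  have hopen : IsOpen {c : ℂ | c₀.re / 2 < c.re} := isOpen_lt continuous_const Complex.continuous_re
  have hmeas : ∀ c : ℂ, AEStronglyMeasurable (fun t : ℝ => Complex.exp (-(c * t)) * r t)
      (volume.restrict (Ioi 0)) := fun c =>
    (Continuous.aestronglyMeasurable (by fun_prop)).mul hr.1
  have h := hasDerivAt_integral_of_dominated_loc_of_deriv_le (μ := volume.restrict (Ioi (0 : ℝ)))
    (F := fun (c : ℂ) (t : ℝ) => Complex.exp (-(c * t)) * r t)
    (F' := fun (c : ℂ) (t : ℝ) => Complex.exp (-(c * t)) * (-t) * r t) (x₀ := c₀)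
    (bound := fun t => t ^ 1 * Real.exp (-(c₀.re / 2 * t)) * ‖r t‖)
    (hopen.mem_nhds (by simp only [mem_ofPred_eq]; linarith))
    (Eventually.of_forall hmeas) ?_ ?_ ?_ ?_ ?_
  · exact h.2.differentiableAt.differentiableWithinAt
  · refine (integrable_pow_mul_exp_mul hr 0 hc₀).mono' (hmeas c₀) (Eventually.of_forall fun t => ?_)
    rw [norm_mul, norm_exp_neg_mul_ofReal, pow_zero, one_mul]
  · exact (Continuous.aestronglyMeasurable (by fun_prop)).mul hr.1
  · filter_upwards [ae_restrict_mem measurableSet_Ioi] with t ht c hc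
    have ht : 0 < t := ht
    have hc : c₀.re / 2 < c.re := hc
    rw [norm_mul, norm_mul, norm_exp_neg_mul_ofReal, norm_neg, Complex.norm_real,
      Real.norm_of_nonneg ht.le, pow_one, mul_comm t]
    gcongr
  · exact integrable_pow_mul_exp_mul hr 1 (by positivity)
  · refine Eventually.of_forall fun t c _ => HasDerivAt.mul_const ?_ _
    refine HasDerivAt.cexp ?_
    exact (hasDerivAt_mul_const (t : ℂ)).fun_neg

/-- Write `e^{-ct} = e^{-t} e^{(1-c)t}` and expand in powers of `1 - c`; `‖1 - c‖ < 1` keeps the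
dominating function exponentially decaying. -/
theorem laplace_eq_zero_near_one {r : ℝ → ℂ} (hr : MemLp r 2 (volume.restrict (Ioi 0)))
    (h : ∀ k : ℕ, ∫ t in Ioi (0 : ℝ), ((t ^ k * Real.exp (-(1 * t)) : ℝ) : ℂ) * r t = 0)
    {c : ℂ} (hc : ‖1 - c‖ < 1) :
    ∫ t in Ioi (0 : ℝ), Complex.exp (-(c * t)) * r t = 0 := by
  have hexp : ∀ t : ℝ, HasSum (fun k : ℕ => ‖1 - c‖ ^ k / k.factorial *
      (t ^ k * Real.exp (-(1 * t)) * ‖r t‖)) (t ^ 0 * Real.exp (-((1 - ‖1 - c‖) * t)) * ‖r t‖) := by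
    intro t
    have h1 := (NormedSpace.expSeries_div_hasSum_exp (‖1 - c‖ * t)).mul_right
      (Real.exp (-(1 * t)) * ‖r t‖)
    rw [← Real.exp_eq_exp_ℝ, ← mul_assoc, ← Real.exp_add] at h1
    convert! h1 using 1
    · ext k
      rw [mul_pow]
      ring
    · ring_nf
  have hsum := hasSum_integral_of_dominated_convergence (μ := volume.restrict (Ioi (0 : ℝ)))
    (F := fun (k : ℕ) (t : ℝ) => ((1 - c) ^ k / k.factorial) *
      (((t ^ k * Real.exp (-(1 * t)) : ℝ) : ℂ) * r t))
    (f := fun t : ℝ => Complex.exp (-(c * t)) * r t)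
    (fun k t => ‖1 - c‖ ^ k / k.factorial * (t ^ k * Real.exp (-(1 * t)) * ‖r t‖))
    (fun k => ((Continuous.aestronglyMeasurable (by fun_prop)).mul hr.1).const_mul _)
    (fun k => ?_) (Eventually.of_forall fun t => (hexp t).summable) ?_ ?_
  · have hz : ∀ k : ℕ, ∫ t in Ioi (0 : ℝ), ((1 - c) ^ k / k.factorial) *
      (((t ^ k * Real.exp (-(1 * t)) : ℝ) : ℂ) * r t) = 0 := fun k => by
      rw [integral_const_mul, h k, mul_zero]
    simp_rw [hz] at hsum
    exact hsum.unique hasSum_zero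
  · filter_upwards [ae_restrict_mem measurableSet_Ioi] with t ht
    have ht : 0 < t := ht
    rw [norm_mul, norm_div, norm_pow, Complex.norm_natCast, norm_mul, Complex.norm_real,
      Real.norm_of_nonneg (by positivity)]
  · simp_rw [fun t => (hexp t).tsum_eq]
    exact integrable_pow_mul_exp_mul hr 0 (by linarith)
  · refine Eventually.of_forall fun t => ?_
    have h1 := (NormedSpace.expSeries_div_hasSum_exp ((1 - c) * t)).mul_right
      (Complex.exp (-(1 * t)) * r t)
    rw [← Complex.exp_eq_exp_ℂ, ← mul_assoc, ← Complex.exp_add] at h1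
    convert! h1 using 1
    · ext k
      rw [mul_pow]
      push_cast
      ring
    · ring_nf

/-- The Laplace transform of `r` vanishes near `1`, hence on the right half-plane by the identity
theorem. On the line `Re c = 1` it is the Fourier transform of `e^{-t} r`, which must therefore
vanish. -/
theorem ae_eq_zero_of_forall_integral_pow_mul_exp {r : ℝ → ℂ}
    (hr : MemLp r 2 (volume.restrict (Ioi 0)))
    (h : ∀ k : ℕ, ∫ t in Ioi (0 : ℝ), ((t ^ k * Real.exp (-(1 * t)) : ℝ) : ℂ) * r t = 0) :
    r =ᵐ[volume.restrict (Ioi 0)] 0 := by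
  have hopen : IsOpen {c : ℂ | 0 < c.re} := isOpen_lt continuous_const Complex.continuous_re
  have hH : EqOn (fun c : ℂ => ∫ t in Ioi (0 : ℝ), Complex.exp (-(c * t)) * r t) 0
      {c : ℂ | 0 < c.re} := by
    refine ((differentiableOn_laplace hr).analyticOnNhd
      hopen).eqOn_zero_of_preconnected_of_eventuallyEq_zero
      (convex_halfSpace_re_gt 0).isPreconnected (z₀ := 1) (by simp) ?_
    filter_upwards [Metric.ball_mem_nhds (1 : ℂ) one_pos] with c hc
    refine laplace_eq_zero_near_one hr h ?_
    rwa [Metric.mem_ball, dist_comm, dist_eq_norm] at hc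
  set w : ℝ → ℂ := (Ioi (0 : ℝ)).indicator fun t => Complex.exp (-(1 * t)) * r t
  have hw : Integrable w := by
    rw [integrable_indicator_iff measurableSet_Ioi]
    refine (integrable_pow_mul_exp_mul hr 0 one_pos).mono'
      ((Continuous.aestronglyMeasurable (by fun_prop)).mul hr.1) (Eventually.of_forall fun t => ?_)
    rw [norm_mul, norm_exp_neg_mul_ofReal, pow_zero, one_mul, Complex.one_re]
  have hw0 : 𝓕 w = 0 := by
    ext ξ
    rw [Real.fourier_eq']
    have h1 := hH (x := 1 + 2 * Real.pi * Complex.I * ξ) (by simp)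
    simp only at h1
    refine Eq.trans ?_ h1
    rw [← integral_indicator measurableSet_Ioi]
    congr 1
    ext t
    by_cases ht : t ∈ Ioi (0 : ℝ)
    · simp only [w, indicator_of_mem ht, smul_eq_mul, ← mul_assoc, ← Complex.exp_add]
      congr 2
      simp
      ring
    · simp [w, indicator_of_notMem ht]
  have := ae_eq_zero_of_fourier_eq_zero hw hw0
  rw [EventuallyEq, ae_restrict_iff' measurableSet_Ioi]
  filter_upwards [this] with t ht ht0
  simpa [w, indicator_of_mem ht0] using ht

/-- The Laguerre functions as elements of `L²(0, ∞)`. -/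
noncomputable def laguerreL2 (m : ℕ) : Lp ℂ 2 (volume.restrict (Ioi (0 : ℝ))) :=
  ((memLp_laguerreFun m).ofReal (K := ℂ)).toLp

theorem coeFn_laguerreL2 (m : ℕ) :
    laguerreL2 m =ᵐ[volume.restrict (Ioi 0)] fun t => (laguerreFun m t : ℂ) :=
  MemLp.coeFn_toLp _

theorem inner_laguerreL2 (m : ℕ) (v : Lp ℂ 2 (volume.restrict (Ioi (0 : ℝ)))) :
    inner ℂ (laguerreL2 m) v = ∫ t in Ioi (0 : ℝ), (laguerreFun m t : ℂ) * v t := by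
  rw [L2.inner_def]
  refine integral_congr_ae ?_
  filter_upwards [coeFn_laguerreL2 m] with t ht
  rw [ht]
  simp [mul_comm]

theorem orthonormal_laguerreL2 : Orthonormal ℂ laguerreL2 := by
  rw [orthonormal_iff_ite]
  intro m n
  rw [inner_laguerreL2]
  have h1 : ∫ t in Ioi (0 : ℝ), (laguerreFun m t : ℂ) * laguerreL2 n t =
      ∫ t in Ioi (0 : ℝ), ((laguerreFun m t * laguerreFun n t : ℝ) : ℂ) := by
    refine integral_congr_ae ?_
    filter_upwards [coeFn_laguerreL2 n] with t ht
    rw [ht]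
    push_cast
    rfl
  rw [h1, integral_complex_ofReal, integral_laguerreFun_mul]
  split_ifs <;> simp

theorem span_laguerreL2_orthogonal : (Submodule.span ℂ (range laguerreL2))ᗮ = ⊥ := by
  rw [Submodule.eq_bot_iff]
  intro r hr
  have hint : ∀ k : ℕ, IntegrableOn
      (fun t : ℝ => ((t ^ k * Real.exp (-(1 * t)) : ℝ) : ℂ) * r t) (Ioi 0) := fun k =>
    ((memLp_pow_mul_exp_neg_mul k one_pos).ofReal (K := ℂ)).integrable_mul (Lp.memLp r)
  have hin : ∀ m, ∑ k ∈ Finset.range (m + 1),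
      ((Real.sqrt 2 * (m.choose k * (-2) ^ k / k.factorial) : ℝ) : ℂ) *
      ∫ t in Ioi (0 : ℝ), ((t ^ k * Real.exp (-(1 * t)) : ℝ) : ℂ) * r t = 0 := fun m => by
    have h1 := (Submodule.mem_orthogonal _ _).1 hr _ (Submodule.subset_span (mem_range_self m))
    rw [inner_laguerreL2] at h1
    rw [← h1]
    simp_rw [laguerreFun_eq_sum, ← integral_const_mul]
    rw [← integral_finsetSum _ fun k _ => (hint k).const_mul _]
    congr 1
    ext t
    push_cast
    rw [Finset.sum_mul]
    exact Finset.sum_congr rfl fun k _ => by ring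
  -- The system is triangular, the coefficient of `t^k` in the `k`-th Laguerre function being
  -- nonzero.
  have hzero : ∀ k : ℕ, ∫ t in Ioi (0 : ℝ), ((t ^ k * Real.exp (-(1 * t)) : ℝ) : ℂ) * r t = 0 := by
    intro k
    induction k using Nat.strong_induction_on with
    | _ k ih =>
      have h1 := hin k
      rw [Finset.sum_range_succ, Finset.sum_eq_zero, zero_add] at h1
      · refine (mul_eq_zero.1 h1).resolve_left ?_
        rw [← ne_eq, Complex.ofReal_ne_zero]
        have : ((-2 : ℝ) ^ k) ≠ 0 := pow_ne_zero _ (by norm_num)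
        simp [Nat.factorial_ne_zero]
      · intro j hj
        rw [ih j (Finset.mem_range.1 hj), mul_zero]
  exact (Lp.eq_zero_iff_ae_eq_zero).2 (ae_eq_zero_of_forall_integral_pow_mul_exp (Lp.memLp r) hzero)

/-- The expansion of a function in `L²(0, ∞)` in Laguerre functions. -/
theorem tendsto_eLpNorm_sub_sum_laguerreFun {g : ℝ → ℂ}
    (hg : MemLp g 2 (volume.restrict (Ioi 0))) :
    Tendsto (fun N : ℕ => eLpNorm (fun t => g t - ∑ m ∈ Finset.range N,
      (∫ s in Ioi (0 : ℝ), (laguerreFun m s : ℂ) * g s) * (laguerreFun m t : ℂ)) 2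
      (volume.restrict (Ioi 0))) atTop (𝓝 0) := by
  let b := HilbertBasis.mkOfOrthogonalEqBot orthonormal_laguerreL2 span_laguerreL2_orthogonal
  have hb : ∀ m, b m = laguerreL2 m := fun m => by
    rw [HilbertBasis.coe_mkOfOrthogonalEqBot]
  have hrep : ∀ m, b.repr (hg.toLp) m = ∫ s in Ioi (0 : ℝ), (laguerreFun m s : ℂ) * g s := fun m => by
    rw [b.repr_apply_apply, hb, inner_laguerreL2]
    refine integral_congr_ae ?_
    filter_upwards [hg.coeFn_toLp] with t ht
    rw [ht]
  have h1 := (b.hasSum_repr (hg.toLp)).tendsto_sum_nat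
  have h2 := (h1.const_sub (hg.toLp)).norm
  rw [sub_self, norm_zero] at h2
  have h3 : ∀ N : ℕ, ‖hg.toLp - ∑ m ∈ Finset.range N, b.repr (hg.toLp) m • b m‖ₑ =
      eLpNorm (fun t => g t - ∑ m ∈ Finset.range N,
      (∫ s in Ioi (0 : ℝ), (laguerreFun m s : ℂ) * g s) * (laguerreFun m t : ℂ)) 2
      (volume.restrict (Ioi 0)) := fun N => by
    rw [Lp.enorm_def]
    refine eLpNorm_congr_ae ?_
    have h4 : ∀ᵐ t ∂(volume.restrict (Ioi (0 : ℝ))), ∀ m, laguerreL2 m t = laguerreFun m t :=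
      ae_all_iff.2 coeFn_laguerreL2
    have h5 : ∀ᵐ t ∂(volume.restrict (Ioi (0 : ℝ))), ∀ m,
        (b.repr (hg.toLp) m • b m : Lp ℂ 2 (volume.restrict (Ioi (0 : ℝ)))) t =
          b.repr (hg.toLp) m * b m t :=
      ae_all_iff.2 fun m => by
        filter_upwards [Lp.coeFn_smul (b.repr (hg.toLp) m) (b m)] with t ht
        rw [ht]; rfl
    filter_upwards [hg.coeFn_toLp, Lp.coeFn_sub (hg.toLp)
      (∑ m ∈ Finset.range N, b.repr (hg.toLp) m • b m), h4, h5,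
      Lp.coeFn_finsetSum (Finset.range N) (fun m => b.repr (hg.toLp) m • b m)]
      with t e1 e2 e4 e5 e6
    rw [e2, Pi.sub_apply, e1, e6, Finset.sum_apply]
    congr 1
    refine Finset.sum_congr rfl fun m _ => ?_
    rw [e5, hrep, hb, e4]
  simp_rw [← h3, ← ofReal_norm]
  simpa using ENNReal.tendsto_ofReal h2

/-! ### Pollaczek values, Delannoy numbers and the coefficients. -/

/-- The values `∑ C(m, k) C(n, k) 2^k` (the Delannoy numbers). -/
def delannoy (m n : ℕ) : ℕ := ∑ k ∈ Finset.range (m + 1), m.choose k * 2 ^ k * n.choose k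

theorem delannoy_eq_sum {m N : ℕ} (h : m < N) (n : ℕ) :
    delannoy m n = ∑ k ∈ Finset.range N, m.choose k * 2 ^ k * n.choose k := by
  rw [delannoy, Finset.sum_subset (Finset.range_subset_range.2 h)]
  intro k _ hk
  rw [Nat.choose_eq_zero_of_lt (by simpa using hk), zero_mul, zero_mul]

theorem delannoy_succ_succ (m n : ℕ) :
    (m + 2) * delannoy (m + 2) n = (2 * n + 1) * delannoy (m + 1) n + (m + 1) * delannoy m n := by
  have hn : ∀ k, n * n.choose k = (k + 1) * n.choose (k + 1) + k * n.choose k := fun k => by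
    rcases le_or_gt k n with h | h
    · have h1 := Nat.choose_succ_right_eq n k
      obtain ⟨d, rfl⟩ := Nat.exists_eq_add_of_le h
      rw [Nat.add_sub_cancel_left] at h1
      linarith
    · rw [Nat.choose_eq_zero_of_lt h, Nat.choose_eq_zero_of_lt (by omega)]
      simp
  have hc : ∀ k, (m + 2) * (m + 2).choose (k + 1) = (2 * k + 3) * (m + 1).choose (k + 1) +
      (k + 1) * (m + 1).choose k + (m + 1) * m.choose (k + 1) := fun k => by
    have h1 := Nat.add_one_mul_choose_eq m k
    have h2 := Nat.add_one_mul_choose_eq (m + 1) k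
    rw [Nat.choose_succ_succ' (m + 1) k] at h2 ⊢
    rw [Nat.choose_succ_succ' m k] at h1 h2 ⊢
    nlinarith
  -- The ranges are padded with zero terms so that, once `k = 0` is split off, all sums run over `m
  -- + 3` indices and compare termwise.
  rw [delannoy_eq_sum (show m + 2 < m + 4 by omega), delannoy_eq_sum (show m + 1 < m + 3 by omega),
    delannoy_eq_sum (show m < m + 4 by omega)]
  have h3 : (2 * n + 1) * ∑ k ∈ Finset.range (m + 3), (m + 1).choose k * 2 ^ k * n.choose k =
      ∑ k ∈ Finset.range (m + 3), (m + 1).choose k * (k + 1) * 2 ^ (k + 1) * n.choose (k + 1) +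
      ∑ k ∈ Finset.range (m + 4), (m + 1).choose k * (2 * k + 1) * 2 ^ k * n.choose k := by
    rw [Finset.sum_range_succ _ (m + 3), Nat.choose_eq_zero_of_lt (show m + 1 < m + 3 by omega),
      Finset.mul_sum]
    simp only [zero_mul, add_zero, ← Finset.sum_add_distrib]
    refine Finset.sum_congr rfl fun k _ => ?_
    rw [pow_succ]
    linear_combination 2 * ((m + 1).choose k * 2 ^ k) * hn k
  rw [h3, Finset.sum_range_succ' _ (m + 3), Finset.sum_range_succ' _ (m + 3),
    Finset.sum_range_succ' _ (m + 3)]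
  simp only [mul_add, Finset.mul_sum]
  have h4 : ∀ k, (m + 2) * ((m + 2).choose (k + 1) * 2 ^ (k + 1) * n.choose (k + 1)) =
      (m + 1).choose k * (k + 1) * 2 ^ (k + 1) * n.choose (k + 1) +
      (m + 1).choose (k + 1) * (2 * (k + 1) + 1) * 2 ^ (k + 1) * n.choose (k + 1) +
      (m + 1) * (m.choose (k + 1) * 2 ^ (k + 1) * n.choose (k + 1)) := fun k => by
    linear_combination (2 ^ (k + 1) * n.choose (k + 1)) * hc k
  rw [Finset.sum_congr rfl fun k _ => h4 k]
  simp only [Finset.sum_add_distrib]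
  simp
  ring_nf

/-- At `ν = -i(n + 1/2)` one has `2ν = -i(2n + 1)`; the factor `i^m` makes the Pollaczek recurrence
real and, through `i² = -1`, turns its minus sign into the plus of `delannoy_succ_succ`. -/
theorem I_pow_mul_aeval_pollaczekPoly (m n : ℕ) :
    Complex.I ^ m * Polynomial.aeval (-Complex.I * ((n : ℂ) + 1 / 2)) (pollaczekPoly m) =
      delannoy m n := by
  induction m using Nat.strong_induction_on with
  | _ m ih =>
    match m with
    | 0 => simp [pollaczekPoly, delannoy]
    | 1 =>
      simp only [pollaczekPoly, delannoy, Finset.sum_range_succ]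
      simp [map_ofNat]
      linear_combination (-2 * (n : ℂ) - 1) * Complex.I_sq
    | m + 2 =>
      have h0 := ih m (by omega)
      have h1 := ih (m + 1) (by omega)
      have hrec := congrArg (Nat.cast : ℕ → ℂ) (delannoy_succ_succ m n)
      push_cast at hrec
      have hne : (m : ℂ) + 2 ≠ 0 := by exact_mod_cast (by omega : m + 2 ≠ 0)
      rw [← h0, ← h1] at hrec
      refine mul_left_cancel₀ hne (Eq.trans ?_ hrec.symm)
      rw [pollaczekPoly]
      simp only [map_mul, map_sub, Polynomial.aeval_C, Polynomial.aeval_X, map_ofNat,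
        Complex.coe_algebraMap]
      push_cast
      field_simp
      rw [pow_add, pow_add, Complex.I_sq]
      ring

/-- Terms with `n < k` vanish and `C(n+k,k)/(n+k)! = 1/(k! n!)`, which leaves the exponential
series. -/
theorem hasSum_alternating_choose_mul_pow (k : ℕ) (t : ℂ) :
    HasSum (fun n : ℕ => (-1) ^ n / (n.factorial : ℂ) * n.choose k * t ^ n)
      ((-1) ^ k / k.factorial * t ^ k * Complex.exp (-t)) := by
  rw [← hasSum_nat_add_iff' k]
  have h0 : ∑ i ∈ Finset.range k, (-1) ^ i / (i.factorial : ℂ) * i.choose k * t ^ i = 0 :=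
    Finset.sum_eq_zero fun i hi => by
      rw [Nat.choose_eq_zero_of_lt (Finset.mem_range.1 hi)]; simp
  rw [h0, sub_zero]
  have h1 := (NormedSpace.expSeries_div_hasSum_exp (-t)).mul_left
    ((-1) ^ k / (k.factorial : ℂ) * t ^ k)
  rw [← Complex.exp_eq_exp_ℂ] at h1
  convert! h1 using 1
  ext n
  have h2 : ((n + k).factorial : ℂ) = (n + k).choose k * n.factorial * k.factorial := by
    rw [← Nat.add_choose_mul_factorial_mul_factorial n k]
    push_cast
    rfl
  have h3 : ((n + k).choose k : ℂ) ≠ 0 := by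
    exact_mod_cast (Nat.choose_pos (by omega)).ne'
  have h4 : (n.factorial : ℂ) ≠ 0 := by exact_mod_cast n.factorial_ne_zero
  have h5 : (k.factorial : ℂ) ≠ 0 := by exact_mod_cast k.factorial_ne_zero
  rw [h2, neg_pow t n, pow_add, pow_add]
  field_simp

theorem hasSum_alternating_choose_mul_moment {a : ℕ → ℂ} {g : ℝ → ℂ}
    (hg : IntegrableOn g (Ioo (0 : ℝ) 1)) (ha : ∀ n, a n = ∫ t in Ioo (0 : ℝ) 1, (t : ℂ) ^ n * g t)
    (k : ℕ) :
    HasSum (fun n : ℕ => (-1) ^ n / (n.factorial : ℂ) * n.choose k * a n)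
      (∫ t in Ioo (0 : ℝ) 1, (-1) ^ k / k.factorial * (t : ℂ) ^ k * Complex.exp (-t) * g t) := by
  have hsummable : Summable fun n : ℕ => (2 : ℝ) ^ n / n.factorial :=
    Real.summable_pow_div_factorial 2
  have h := hasSum_integral_of_dominated_convergence (μ := volume.restrict (Ioo (0 : ℝ) 1))
    (F := fun (n : ℕ) (t : ℝ) => (-1) ^ n / (n.factorial : ℂ) * n.choose k * ((t : ℂ) ^ n * g t))
    (f := fun t : ℝ => (-1) ^ k / k.factorial * (t : ℂ) ^ k * Complex.exp (-t) * g t)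
    (fun n t => (2 : ℝ) ^ n / n.factorial * ‖g t‖)
    (fun n => ((Continuous.aestronglyMeasurable (by fun_prop)).mul hg.1).const_mul _)
    (fun n => ?_) (Eventually.of_forall fun t => hsummable.mul_right _) ?_ ?_
  · simp_rw [integral_const_mul, ← ha] at h
    exact h
  · filter_upwards [ae_restrict_mem measurableSet_Ioo] with t ht
    rw [norm_mul, norm_mul, norm_div, norm_pow, norm_neg, norm_one, one_pow, Complex.norm_natCast,
      Complex.norm_natCast, norm_mul, norm_pow, Complex.norm_real, Real.norm_of_nonneg ht.1.le]
    have h1 : (n.choose k : ℝ) ≤ 2 ^ n := by exact_mod_cast Nat.choose_le_two_pow n k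
    have h2 : t ^ n ≤ 1 := pow_le_one₀ ht.1.le ht.2.le
    have h3 : 0 ≤ t ^ n := pow_nonneg ht.1.le n
    calc 1 / (n.factorial : ℝ) * n.choose k * (t ^ n * ‖g t‖)
        ≤ 1 / (n.factorial : ℝ) * 2 ^ n * (1 * ‖g t‖) := by gcongr
      _ = _ := by ring
  · simp_rw [tsum_mul_right]
    exact hg.norm.const_mul _
  · refine Eventually.of_forall fun t => ?_
    have := (hasSum_alternating_choose_mul_pow k (t : ℂ)).mul_right (g t)
    simpa only [mul_assoc] using this

/-- Weighting the previous sums by `C(m,k) 2^k` produces Delannoy numbers on the series side and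
`L_m(2t) e^{-t}` under the integral. -/
theorem hasSum_I_pow_mul_pollaczekTerm {a : ℕ → ℂ} {g : ℝ → ℂ}
    (hg : IntegrableOn g (Ioo (0 : ℝ) 1)) (ha : ∀ n, a n = ∫ t in Ioo (0 : ℝ) 1, (t : ℂ) ^ n * g t)
    (m : ℕ) :
    HasSum (fun n : ℕ => (Real.sqrt 2 : ℂ) * (Complex.I ^ m * pollaczekTerm a m n))
      (∫ t in Ioo (0 : ℝ) 1, (laguerreFun m t : ℂ) * g t) := by
  have h := (hasSum_sum (s := Finset.range (m + 1)) fun k _ =>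
    (hasSum_alternating_choose_mul_moment hg ha k).mul_left ((m.choose k * 2 ^ k : ℕ) : ℂ)).mul_left
      (Real.sqrt 2 : ℂ)
  have hint : ∀ k : ℕ, IntegrableOn (fun t : ℝ =>
      ((m.choose k * 2 ^ k : ℕ) : ℂ) *
        ((-1) ^ k / k.factorial * (t : ℂ) ^ k * Complex.exp (-t) * g t)) (Ioo (0 : ℝ) 1) := by
    intro k
    refine Integrable.const_mul ?_ _
    refine hg.bdd_mul (c := 1) (Continuous.aestronglyMeasurable (by fun_prop)) ?_
    filter_upwards [ae_restrict_mem measurableSet_Ioo] with t ht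
    have hk : (1 : ℝ) ≤ k.factorial := by exact_mod_cast Nat.succ_le_of_lt k.factorial_pos
    rw [norm_mul, norm_mul, norm_div, norm_pow, norm_neg, norm_one, one_pow, Complex.norm_natCast,
      norm_pow, Complex.norm_real, Real.norm_of_nonneg ht.1.le, Complex.norm_exp]
    have h1 : 1 / (k.factorial : ℝ) ≤ 1 := div_le_one_of_le₀ hk (by positivity)
    have h2 : t ^ k ≤ 1 := pow_le_one₀ ht.1.le ht.2.le
    have h3 : Real.exp (-(t : ℂ)).re ≤ 1 := by
      rw [Real.exp_le_one_iff]
      simpa using ht.1.le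
    have h4 : 0 ≤ t ^ k := pow_nonneg ht.1.le k
    exact mul_le_one₀ (mul_le_one₀ h1 h4 h2) (Real.exp_nonneg _) h3
  convert! h using 1
  · ext n
    rw [pollaczekTerm]
    have := I_pow_mul_aeval_pollaczekPoly m n
    rw [delannoy] at this
    have h2 : Complex.I ^ m * ((-1) ^ n / (n.factorial : ℂ) * a n *
        Polynomial.aeval (-Complex.I * ((n : ℂ) + 1 / 2)) (pollaczekPoly m)) =
        (-1) ^ n / (n.factorial : ℂ) * a n * (Complex.I ^ m *
        Polynomial.aeval (-Complex.I * ((n : ℂ) + 1 / 2)) (pollaczekPoly m)) := by ring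
    rw [h2, this]
    push_cast
    rw [Finset.mul_sum]
    congr 1
    exact Finset.sum_congr rfl fun k _ => by ring
  · simp_rw [← integral_const_mul]
    rw [← integral_finsetSum _ fun k _ => hint k, ← integral_const_mul]
    congr 1
    ext t
    rw [laguerreFun_eq_sum]
    push_cast
    rw [Finset.sum_mul, Finset.mul_sum]
    refine Finset.sum_congr rfl fun k _ => ?_
    rw [show (-2 : ℂ) = (-1) * 2 by norm_num, mul_pow, one_mul]
    ring

theorem summable_pollaczekTerm {a : ℕ → ℂ} {g : ℝ → ℂ}
    (hg : IntegrableOn g (Ioo (0 : ℝ) 1)) (ha : ∀ n, a n = ∫ t in Ioo (0 : ℝ) 1, (t : ℂ) ^ n * g t)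
    (m : ℕ) : Summable (pollaczekTerm a m) := by
  have h := (hasSum_I_pow_mul_pollaczekTerm hg ha m).summable
  have h2 : (Real.sqrt 2 : ℂ) ≠ 0 := by simp
  have h3 : Complex.I ^ m ≠ 0 := pow_ne_zero _ Complex.I_ne_zero
  rwa [summable_mul_left_iff h2, summable_mul_left_iff h3] at h

theorem pollaczekCoeff_mul_laguerreBasisFun {a : ℕ → ℂ} {g : ℝ → ℂ}
    (hg : IntegrableOn g (Ioo (0 : ℝ) 1)) (ha : ∀ n, a n = ∫ t in Ioo (0 : ℝ) 1, (t : ℂ) ^ n * g t)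
    (m : ℕ) (x : ℝ) :
    pollaczekCoeff a m * laguerreBasisFun m x =
      (∫ t in Ioo (0 : ℝ) 1, (laguerreFun m t : ℂ) * g t) * (laguerreFun m x⁻¹ : ℂ) * (x⁻¹ : ℝ) := by
  rw [← (hasSum_I_pow_mul_pollaczekTerm hg ha m).tsum_eq, tsum_mul_left, tsum_mul_left,
    pollaczekCoeff, laguerreBasisFun, laguerreFun]
  simp only [div_eq_mul_inv, neg_mul, one_mul]
  push_cast
  ring

/-! ### The holomorphic extension to the cut plane. -/

theorem isOpen_cutPlane : IsOpen cutPlane := by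
  have : cutPlane = {z : ℂ | z.im ≠ 0} ∪ {z : ℂ | z.re < 1} := rfl
  rw [this]
  exact (isOpen_ne_fun Complex.continuous_im continuous_const).union
    (isOpen_lt Complex.continuous_re continuous_const)

theorem zero_mem_cutPlane : (0 : ℂ) ∈ cutPlane := Or.inr (by simp)

theorem isPreconnected_cutPlane : IsPreconnected cutPlane := by
  have hstar : StarConvex ℝ 0 cutPlane := by
    rw [starConvex_zero_iff]
    intro z hz a ha0 ha1
    rcases ha0.eq_or_lt with rfl | ha
    · rw [zero_smul]
      exact zero_mem_cutPlane
    · rcases hz with hz | hz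
      · left
        simpa using ⟨ha.ne', hz⟩
      · right
        simp only [Complex.real_smul, Complex.re_ofReal_mul]
        nlinarith
  exact (hstar.isPathConnected zero_mem_cutPlane).isConnected.isPreconnected

theorem one_sub_ofReal_mul_ne_zero {z : ℂ} (hz : z ∈ cutPlane) {t : ℝ} (ht : t ∈ Icc (0 : ℝ) 1) :
    1 - t * z ≠ 0 := by
  intro h
  have hre := congrArg Complex.re h
  have him := congrArg Complex.im h
  simp at hre him
  rcases him with h0 | h0
  · rw [h0] at hre
    simp at hre
  · rcases hz with hz | hz
    · exact hz h0
    · rcases ht.1.eq_or_lt with rfl | ht0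
      · simp at hre
      · nlinarith [ht.2, mul_lt_mul_of_pos_left hz ht0]

/-- Compactness of `[0,1]` times a closed ball in the cut plane gives the uniform bound needed to
differentiate under the integral. -/
theorem exists_le_norm_one_sub_mul {z₀ : ℂ} (hz₀ : z₀ ∈ cutPlane) :
    ∃ r δ : ℝ, 0 < r ∧ 0 < δ ∧ ∀ z ∈ Metric.ball z₀ r, z ∈ cutPlane ∧
      ∀ t ∈ Icc (0 : ℝ) 1, δ ≤ ‖1 - t * z‖ := by
  obtain ⟨r, hr, hsub⟩ := Metric.nhds_basis_closedBall.mem_iff.1 (isOpen_cutPlane.mem_nhds hz₀)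
  have hcomp : IsCompact (Icc (0 : ℝ) 1 ×ˢ Metric.closedBall z₀ r) :=
    isCompact_Icc.prod (isCompact_closedBall _ _)
  obtain ⟨p, hp, hmin⟩ := hcomp.exists_isMinOn
    ⟨(0, z₀), by simp [hr.le]⟩
    (f := fun p : ℝ × ℂ => ‖1 - p.1 * p.2‖) (Continuous.continuousOn (by fun_prop))
  refine ⟨r, ‖1 - p.1 * p.2‖, hr,
    norm_pos_iff.2 (one_sub_ofReal_mul_ne_zero (hsub hp.2) hp.1), fun z hz => ?_⟩
  have hz' := Metric.ball_subset_closedBall hz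
  exact ⟨hsub hz', fun t ht => hmin (show (t, z) ∈ _ from ⟨ht, hz'⟩)⟩

/-- The Cauchy-type integral `(1 / 2π) ∫₀¹ g(t) / (1 - t z) dt`. -/
noncomputable def momentTransform (g : ℝ → ℂ) (z : ℂ) : ℂ :=
  1 / (2 * (Real.pi : ℂ)) * ∫ t in Ioo (0 : ℝ) 1, g t * (1 - t * z)⁻¹

theorem aestronglyMeasurable_mul_inv_one_sub {g : ℝ → ℂ} (hg : IntegrableOn g (Ioo (0 : ℝ) 1))
    (z : ℂ) :
    AEStronglyMeasurable (fun t : ℝ => g t * (1 - t * z)⁻¹) (volume.restrict (Ioo (0 : ℝ) 1)) :=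
  hg.1.mul (Measurable.aestronglyMeasurable (by fun_prop))

theorem integrableOn_mul_inv_one_sub {g : ℝ → ℂ} (hg : IntegrableOn g (Ioo (0 : ℝ) 1))
    {z : ℂ} (hz : z ∈ cutPlane) :
    IntegrableOn (fun t : ℝ => g t * (1 - t * z)⁻¹) (Ioo (0 : ℝ) 1) := by
  obtain ⟨r, δ, hr, hδ, hb⟩ := exists_le_norm_one_sub_mul hz
  refine (hg.norm.mul_const δ⁻¹).mono' (aestronglyMeasurable_mul_inv_one_sub hg z) ?_
  filter_upwards [ae_restrict_mem measurableSet_Ioo] with t ht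
  rw [norm_mul, norm_inv]
  gcongr
  exact (hb z (Metric.mem_ball_self hr)).2 t ⟨ht.1.le, ht.2.le⟩

theorem differentiableOn_momentTransform {g : ℝ → ℂ} (hg : IntegrableOn g (Ioo (0 : ℝ) 1)) :
    DifferentiableOn ℂ (momentTransform g) cutPlane := by
  intro z₀ hz₀
  obtain ⟨r, δ, hr, hδ, hb⟩ := exists_le_norm_one_sub_mul hz₀
  have h := hasDerivAt_integral_of_dominated_loc_of_deriv_le (μ := volume.restrict (Ioo (0 : ℝ) 1))
    (F := fun (z : ℂ) (t : ℝ) => g t * (1 - t * z)⁻¹)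
    (F' := fun (z : ℂ) (t : ℝ) => g t * (t / (1 - t * z) ^ 2)) (x₀ := z₀)
    (bound := fun t => ‖g t‖ * (1 / δ ^ 2))
    (Metric.ball_mem_nhds z₀ hr)
    (Eventually.of_forall (aestronglyMeasurable_mul_inv_one_sub hg))
    (integrableOn_mul_inv_one_sub hg hz₀)
    (hg.1.mul (Measurable.aestronglyMeasurable (by fun_prop))) ?_ (hg.norm.mul_const _) ?_
  · exact (h.2.differentiableAt.const_mul _).differentiableWithinAt
  · filter_upwards [ae_restrict_mem measurableSet_Ioo] with t ht z hz
    rw [norm_mul, norm_div, norm_pow, Complex.norm_real, Real.norm_of_nonneg ht.1.le]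
    have := (hb z hz).2 t ⟨ht.1.le, ht.2.le⟩
    have := ht.2.le
    gcongr
  · filter_upwards [ae_restrict_mem measurableSet_Ioo] with t ht z hz
    refine HasDerivAt.const_mul _ ?_
    have h1 : HasDerivAt (fun z : ℂ => 1 - t * z) (-(t : ℂ)) z := by
      simpa using! ((hasDerivAt_id z).const_mul (t : ℂ)).const_sub 1
    have h2 := h1.fun_inv (one_sub_ofReal_mul_ne_zero (hb z hz).1 ⟨ht.1.le, ht.2.le⟩)
    rwa [neg_neg] at h2

theorem hasSum_momentTransform {g : ℝ → ℂ} (hg : IntegrableOn g (Ioo (0 : ℝ) 1))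
    {a : ℕ → ℂ}
    (ha : ∀ n, a n = ∫ t in Ioo (0 : ℝ) 1, (t : ℂ) ^ n * g t) {z : ℂ} (hz : ‖z‖ < 1) :
    HasSum (fun n : ℕ => 1 / (2 * (Real.pi : ℂ)) * (a n * z ^ n)) (momentTransform g z) := by
  refine HasSum.mul_left _ ?_
  have hgeo := hasSum_geometric_of_lt_one (norm_nonneg z) hz
  have h := hasSum_integral_of_dominated_convergence (μ := volume.restrict (Ioo (0 : ℝ) 1))
    (F := fun (n : ℕ) (t : ℝ) => z ^ n * ((t : ℂ) ^ n * g t))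
    (f := fun t : ℝ => g t * (1 - t * z)⁻¹)
    (fun n t => ‖z‖ ^ n * ‖g t‖)
    (fun n => ((Continuous.aestronglyMeasurable (by fun_prop)).mul hg.1).const_mul _)
    (fun n => ?_) (Eventually.of_forall fun t => hgeo.summable.mul_right _) ?_ ?_
  · simp_rw [integral_const_mul, ← ha] at h
    simpa only [mul_comm] using h
  · filter_upwards [ae_restrict_mem measurableSet_Ioo] with t ht
    rw [norm_mul, norm_mul, norm_pow, norm_pow, Complex.norm_real, Real.norm_of_nonneg ht.1.le]
    gcongr
    exact mul_le_of_le_one_left (norm_nonneg _) (pow_le_one₀ ht.1.le ht.2.le)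
  · simp_rw [tsum_mul_right]
    exact hg.norm.const_mul _
  · filter_upwards [ae_restrict_mem measurableSet_Ioo] with t ht
    have hlt : ‖(t : ℂ) * z‖ < 1 := by
      rw [norm_mul, Complex.norm_real, Real.norm_of_nonneg ht.1.le]
      nlinarith [ht.1, ht.2, norm_nonneg z]
    have := (hasSum_geometric_of_norm_lt_one hlt).mul_left (g t)
    convert! this using 1
    ext n
    rw [mul_pow]
    ring

theorem isCutPlaneExtension_momentTransform {g : ℝ → ℂ} (hg : IntegrableOn g (Ioo (0 : ℝ) 1))
    {a : ℕ → ℂ}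
    (ha : ∀ n, a n = ∫ t in Ioo (0 : ℝ) 1, (t : ℂ) ^ n * g t) :
    IsCutPlaneExtension a (momentTransform g) :=
  ⟨differentiableOn_momentTransform hg, fun _ hz => hasSum_momentTransform hg ha hz⟩

theorem IsCutPlaneExtension.eqOn {a : ℕ → ℂ} {f₁ f₂ : ℂ → ℂ} (h₁ : IsCutPlaneExtension a f₁)
    (h₂ : IsCutPlaneExtension a f₂) : EqOn f₁ f₂ cutPlane := by
  refine (h₁.1.analyticOnNhd isOpen_cutPlane).eqOn_of_preconnected_of_eventuallyEq
    (h₂.1.analyticOnNhd isOpen_cutPlane) isPreconnected_cutPlane zero_mem_cutPlane ?_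
  filter_upwards [Metric.ball_mem_nhds (0 : ℂ) one_pos] with z hz
  rw [mem_ball_zero_iff] at hz
  exact (h₁.2 z hz).unique (h₂.2 z hz)

/-! ### The substitution `x = 1/t`, the jump function and its expansion. -/

theorem image_inv_Ioi_one : (fun x : ℝ => x⁻¹) '' Ioi 1 = Ioo 0 1 := by
  ext t
  constructor
  · rintro ⟨x, hx, rfl⟩
    have hx : (1 : ℝ) < x := hx
    exact ⟨by positivity, inv_lt_one_of_one_lt₀ hx⟩
  · intro ht
    exact ⟨t⁻¹, (one_lt_inv₀ ht.1).2 ht.2, inv_inv t⟩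

theorem hasDerivWithinAt_inv_Ioi_one (x : ℝ) (hx : x ∈ Ioi (1 : ℝ)) :
    HasDerivWithinAt (fun x : ℝ => x⁻¹) (-(x ^ 2)⁻¹) (Ioi 1) x :=
  (hasDerivAt_inv (zero_lt_one.trans hx).ne').hasDerivWithinAt

/-- The weight `1/x` is the square root of the Jacobian `1/x²`. -/
theorem eLpNorm_comp_inv_mul_inv (u : ℝ → ℂ) :
    eLpNorm (fun x : ℝ => u x⁻¹ * (x⁻¹ : ℝ)) 2 (volume.restrict (Ioi 1)) =
      eLpNorm u 2 (volume.restrict (Ioo 0 1)) := by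
  rw [eLpNorm_eq_lintegral_rpow_enorm_toReal (by norm_num) (by norm_num),
    eLpNorm_eq_lintegral_rpow_enorm_toReal (by norm_num) (by norm_num), ← image_inv_Ioi_one,
    lintegral_image_eq_lintegral_abs_deriv_mul measurableSet_Ioi hasDerivWithinAt_inv_Ioi_one
      inv_injective.injOn]
  congr 1
  refine setLIntegral_congr_fun measurableSet_Ioi fun x hx => ?_
  have hx : 0 < x := zero_lt_one.trans hx
  simp only [ENNReal.toReal_ofNat, ENNReal.rpow_ofNat]
  rw [enorm_mul, mul_pow, mul_comm, abs_neg, abs_of_pos (by positivity), ← inv_pow,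
    ENNReal.ofReal_pow (by positivity)]
  congr 2
  rw [← ofReal_norm, Complex.norm_real, Real.norm_of_nonneg (by positivity)]

theorem abs_deriv_smul_mul_inv_one_sub (g : ℝ → ℂ) (z : ℂ) {x : ℝ} (hx : x ∈ Ioi (1 : ℝ)) :
    |-(x ^ 2)⁻¹| • (g x⁻¹ * (1 - (x⁻¹ : ℝ) * z)⁻¹) = g x⁻¹ * (x⁻¹ : ℝ) / (x - z) := by
  have hx : 0 < x := zero_lt_one.trans hx
  have hx' : (x : ℂ) ≠ 0 := by exact_mod_cast hx.ne'
  have h1 : 1 - ((x⁻¹ : ℝ) : ℂ) * z = (x : ℂ)⁻¹ * (x - z) := by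
    push_cast
    field_simp
  rw [h1, mul_inv, inv_inv, abs_neg, abs_of_pos (by positivity), Complex.real_smul]
  push_cast
  field_simp

theorem integrableOn_comp_inv_div {g : ℝ → ℂ} (hg : IntegrableOn g (Ioo (0 : ℝ) 1)) {z : ℂ}
    (hz : z ∈ cutPlane) :
    IntegrableOn (fun x : ℝ => g x⁻¹ * (x⁻¹ : ℝ) / (x - z)) (Ioi 1) := by
  have h := integrableOn_mul_inv_one_sub hg hz
  rw [← image_inv_Ioi_one, integrableOn_image_iff_integrableOn_abs_deriv_smul measurableSet_Ioi
    hasDerivWithinAt_inv_Ioi_one inv_injective.injOn] at h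
  exact h.congr_fun (fun x hx => abs_deriv_smul_mul_inv_one_sub g z hx) measurableSet_Ioi

theorem momentTransform_eq_integral_Ioi (g : ℝ → ℂ) (z : ℂ) :
    momentTransform g z =
      1 / (2 * (Real.pi : ℂ)) * ∫ x in Ioi (1 : ℝ), g x⁻¹ * (x⁻¹ : ℝ) / (x - z) := by
  rw [momentTransform, ← image_inv_Ioi_one, integral_image_eq_integral_abs_deriv_smul
    measurableSet_Ioi hasDerivWithinAt_inv_Ioi_one inv_injective.injOn]
  congr 1
  exact setIntegral_congr_fun measurableSet_Ioi
    fun x hx => abs_deriv_smul_mul_inv_one_sub g z hx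

theorem memLp_comp_inv_mul_inv {g : ℝ → ℂ} (hg : Measurable g)
    (hg2 : MemLp g 2 (volume.restrict (Ioo (0 : ℝ) 1))) :
    MemLp (fun x : ℝ => g x⁻¹ * (x⁻¹ : ℝ)) 2 (volume.restrict (Ioi 1)) := by
  refine ⟨Measurable.aestronglyMeasurable (by fun_prop), ?_⟩
  rw [eLpNorm_comp_inv_mul_inv]
  exact hg2.2

theorem add_I_mul_mem_cutPlane (x : ℝ) {ε : ℝ} (hε : ε ≠ 0) : (x : ℂ) + Complex.I * ε ∈ cutPlane :=
  Or.inl (by simpa using hε)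

theorem sub_I_mul_mem_cutPlane (x : ℝ) {ε : ℝ} (hε : ε ≠ 0) : (x : ℂ) - Complex.I * ε ∈ cutPlane :=
  Or.inl (by simpa using hε)

theorem IsJumpFunction.ae_eq {f : ℂ → ℂ} {F₁ F₂ : ℝ → ℂ} (h₁ : IsJumpFunction f F₁)
    (h₂ : IsJumpFunction f F₂) : F₁ =ᵐ[volume.restrict (Ioi 1)] F₂ := by
  filter_upwards [h₁, h₂] with x ⟨p, m, hp, hm, h⟩ ⟨p', m', hp', hm', h'⟩
  rw [h, h', tendsto_nhds_unique hp hp', tendsto_nhds_unique hm hm']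

theorem IsJumpFunction.congr {f₁ f₂ : ℂ → ℂ} {F : ℝ → ℂ} (h : IsJumpFunction f₁ F)
    (hf : EqOn f₁ f₂ cutPlane) : IsJumpFunction f₂ F := by
  filter_upwards [h] with x ⟨p, m, hp, hm, h⟩
  refine ⟨p, m, hp.congr' ?_, hm.congr' ?_, h⟩
  · filter_upwards [self_mem_nhdsWithin] with ε hε
    exact hf (add_I_mul_mem_cutPlane x (ne_of_gt hε))
  · filter_upwards [self_mem_nhdsWithin] with ε hε
    exact hf (sub_I_mul_mem_cutPlane x (ne_of_gt hε))

theorem isJumpFunction_momentTransform {g : ℝ → ℂ} (hg : Measurable g)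
    (hg2 : MemLp g 2 (volume.restrict (Ioo (0 : ℝ) 1))) :
    IsJumpFunction (momentTransform g) fun x : ℝ => g x⁻¹ * (x⁻¹ : ℝ) := by
  set F : ℝ → ℂ := fun x : ℝ => g x⁻¹ * (x⁻¹ : ℝ)
  have hu : MemLp ((Ioi (1 : ℝ)).indicator F) 2 :=
    (memLp_indicator_iff_restrict measurableSet_Ioi).2 (memLp_comp_inv_mul_inv hg hg2)
  have hint : ∀ z : ℂ, 1 / (2 * (Real.pi : ℂ)) * ∫ y : ℝ,
      (Ioi (1 : ℝ)).indicator F y * ((y : ℂ) - z)⁻¹ = momentTransform g z := fun z => by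
    rw [momentTransform_eq_integral_Ioi, ← integral_indicator measurableSet_Ioi]
    congr 2
    ext y
    by_cases hy : y ∈ Ioi (1 : ℝ)
    · simp only [indicator_of_mem hy, div_eq_mul_inv, F]
    · simp [indicator_of_notMem hy]
  have hpi : (Real.pi : ℂ) ≠ 0 := by exact_mod_cast Real.pi_ne_zero
  rw [IsJumpFunction, ae_restrict_iff' measurableSet_Ioi]
  filter_upwards [exists_tendsto_cauchyIntegral_ae hu] with x ⟨p, m, hp, hm, h⟩ hx
  refine ⟨1 / (2 * (Real.pi : ℂ)) * p, 1 / (2 * (Real.pi : ℂ)) * m, ?_, ?_, ?_⟩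
  · exact (hp.const_mul _).congr fun ε => hint _
  · exact (hm.const_mul _).congr fun ε => hint _
  · rw [indicator_of_mem hx] at h
    rw [← mul_sub, h]
    field_simp
    linear_combination F x * Complex.I_sq

theorem tendsto_eLpNorm_sub_sum_pollaczekCoeff {a : ℕ → ℂ} {g : ℝ → ℂ}
    (hg : MemLp g 2 (volume.restrict (Ioo (0 : ℝ) 1)))
    (ha : ∀ n, a n = ∫ t in Ioo (0 : ℝ) 1, (t : ℂ) ^ n * g t) :
    Tendsto (fun N : ℕ => eLpNorm (fun x : ℝ => g x⁻¹ * (x⁻¹ : ℝ) -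
      ∑ m ∈ Finset.range N, pollaczekCoeff a m * laguerreBasisFun m x) 2
      (volume.restrict (Ioi 1))) atTop (𝓝 0) := by
  have hg1 : IntegrableOn g (Ioo (0 : ℝ) 1) := hg.integrable one_le_two
  have hsub : Ioo (0 : ℝ) 1 ⊆ Ioi 0 := fun t ht => ht.1
  have hG : MemLp ((Ioo (0 : ℝ) 1).indicator g) 2 (volume.restrict (Ioi 0)) := by
    rw [memLp_indicator_iff_restrict measurableSet_Ioo,
      Measure.restrict_restrict_of_subset hsub]
    exact hg
  have hcoef : ∀ m, ∫ s in Ioi (0 : ℝ), (laguerreFun m s : ℂ) * (Ioo (0 : ℝ) 1).indicator g s =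
      ∫ t in Ioo (0 : ℝ) 1, (laguerreFun m t : ℂ) * g t := fun m => by
    rw [← Measure.restrict_restrict_of_subset hsub, ← integral_indicator measurableSet_Ioo]
    congr 1
    ext s
    by_cases hs : s ∈ Ioo (0 : ℝ) 1
    · simp only [indicator_of_mem hs]
    · simp [indicator_of_notMem hs]
  have h := tendsto_eLpNorm_sub_sum_laguerreFun hG
  simp_rw [hcoef] at h
  -- Restricting from `(0,∞)` to `(0,1)` can only lower the norm of the error; the isometry then
  -- carries it to `(1,∞)`.
  refine tendsto_of_tendsto_of_tendsto_of_le_of_le tendsto_const_nhds h (fun _ => zero_le)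
    fun N => ?_
  have h1 : (fun x : ℝ => g x⁻¹ * (x⁻¹ : ℝ) -
      ∑ m ∈ Finset.range N, pollaczekCoeff a m * laguerreBasisFun m x) =
      fun x : ℝ => (fun t : ℝ => g t - ∑ m ∈ Finset.range N,
        (∫ s in Ioo (0 : ℝ) 1, (laguerreFun m s : ℂ) * g s) * (laguerreFun m t : ℂ)) x⁻¹ *
        (x⁻¹ : ℝ) := by
    ext x
    simp_rw [pollaczekCoeff_mul_laguerreBasisFun hg1 ha]
    rw [sub_mul, Finset.sum_mul]
  simp only
  rw [h1, eLpNorm_comp_inv_mul_inv (fun t : ℝ => g t - ∑ m ∈ Finset.range N,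
    (∫ s in Ioo (0 : ℝ) 1, (laguerreFun m s : ℂ) * g s) * (laguerreFun m t : ℂ))]
  refine (eLpNorm_congr_ae ?_).trans_le (eLpNorm_mono_measure _ (Measure.restrict_mono hsub le_rfl))
  filter_upwards [ae_restrict_mem measurableSet_Ioo] with t ht
  rw [indicator_of_mem ht]

theorem theorem2 (a : ℕ → ℂ) (ha : HausdorffL2Condition a) :
    -- the sums that define the coefficients converge
    (∀ m : ℕ, Summable (pollaczekTerm a m)) ∧
    -- the Taylor series extends holomorphically to the cut plane
    (∃ f : ℂ → ℂ, IsCutPlaneExtension a f) ∧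
    ∀ f : ℂ → ℂ, IsCutPlaneExtension a f →
      -- the extension has a jump function across the cut
      (∃ F : ℝ → ℂ, IsJumpFunction f F) ∧
      ∀ F : ℝ → ℂ, IsJumpFunction f F →
        MeasureTheory.MemLp F 2 (MeasureTheory.volume.restrict (Set.Ioi (1 : ℝ))) ∧
        -- the jump function is the sum of the series, in the norm of `L²(1, ∞)`
        Filter.Tendsto
          (fun N : ℕ => MeasureTheory.eLpNorm
            (fun x : ℝ => F x -
              ∑ m ∈ Finset.range N, pollaczekCoeff a m * laguerreBasisFun m x) 2
            (MeasureTheory.volume.restrict (Set.Ioi (1 : ℝ))))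
          Filter.atTop (nhds 0) ∧
        -- and it solves the Cauchy integral equation
        ∀ z ∈ cutPlane,
          MeasureTheory.IntegrableOn (fun x : ℝ => F x / ((x : ℂ) - z)) (Set.Ioi (1 : ℝ)) ∧
          f z = 1 / (2 * (Real.pi : ℂ)) * ∫ x in Set.Ioi (1 : ℝ), F x / ((x : ℂ) - z) := by
  obtain ⟨g, hgm, hg2, hmom⟩ := ha.exists_moments
  have hg1 : MeasureTheory.IntegrableOn g (Set.Ioo (0 : ℝ) 1) := hg2.integrable one_le_two
  have hext := isCutPlaneExtension_momentTransform hg1 hmom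
  refine ⟨summable_pollaczekTerm hg1 hmom, ⟨_, hext⟩, fun f hf => ?_⟩
  -- An arbitrary extension and jump function agree with the explicit ones, on the cut plane and
  -- almost everywhere respectively, so every claim is transferred from those.
  have hfeq := hext.eqOn hf
  have hjump := (isJumpFunction_momentTransform hgm.measurable hg2).congr hfeq
  refine ⟨⟨_, hjump⟩, fun F hF => ?_⟩
  have hFae := hF.ae_eq hjump
  refine ⟨(memLp_comp_inv_mul_inv hgm.measurable hg2).ae_eq hFae.symm, ?_, fun z hz => ?_⟩
  · refine (tendsto_eLpNorm_sub_sum_pollaczekCoeff hg2 hmom).congr fun N => ?_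
    refine MeasureTheory.eLpNorm_congr_ae ?_
    filter_upwards [hFae] with x hx
    rw [hx]
  · have hae : (fun x : ℝ => F x / ((x : ℂ) - z)) =ᵐ[MeasureTheory.volume.restrict (Set.Ioi 1)]
        fun x : ℝ => g x⁻¹ * (x⁻¹ : ℝ) / (x - z) := by
      filter_upwards [hFae] with x hx
      rw [hx]
    refine ⟨(integrableOn_comp_inv_div hg1 hz).congr hae.symm, ?_⟩
    rw [MeasureTheory.integral_congr_ae hae, ← momentTransform_eq_integral_Ioi]
    exact (hfeq hz).symm
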